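/- For a field $K$ and a finite group $\Gamma$, let $\{x_g\}_{g\in\Gamma}$ be independent variables indexed by $\Gamma$, and let $\Gamma$ act on the rational function field $K(x_g : g\in\Gamma)$ by $K$-automorphisms with $h(x_g)=x_{hg}$ for all $h,g\in\Gamma$. Say that Noether's problem for $\Gamma$ has a positive answer over $K$ if the fixed field $K(x_g : g\in\Gamma)^{\Gamma}$ is rational (that is, purely transcendental) over $K$. Let $K$ be a field with $\operatorname{char} K\neq 2,3$. 1. If $G$ is a transitive subgroup of the symmetric group $S_6$ that contains a subgroup isomorphic to $C_3\times C_3$, and $G\neq A_6$, $G\neq S_6$, then Noether's problem for $G$ has a positive answer over $K$. 2. If moreover $\operatorname{char} K\neq 5$, then Noether's problem for $S_6$ has a positive answer over $K$. -/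

import Mathlib

/-- An extension `F` of a field `K` is rational (that is, purely transcendental) if `F = K(s)`
for some set `s` of elements of `F` that is algebraically independent over `K`. -/
def IsRationalOver (K F : Type*) [Field K] [Field F] [Algebra K F] : Prop :=
  ∃ s : Set F, AlgebraicIndependent K (Subtype.val : s → F) ∧ IntermediateField.adjoin K s = ⊤

/-- The rational function field `K(x_i : i ∈ σ)`. -/
abbrev RatFuncField (σ K : Type*) [Field K] : Type _ :=
  FractionRing (MvPolynomial σ K)

/-- The action of `Γ` on the polynomial ring `K[x_g : g ∈ Γ]` by `h(x_g) = x_{hg}`, trivial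
on `K`. -/
noncomputable def regularPolyAction (Γ K : Type*) [Group Γ] [Field K] :
    Γ →* (MvPolynomial Γ K ≃ₐ[K] MvPolynomial Γ K) where
  toFun h := MvPolynomial.renameEquiv K (Equiv.mulLeft h)
  map_one' := by
    ext p
    simp
  map_mul' a b := by
    ext p
    simp [MvPolynomial.rename_rename, Function.comp_def]

/-- The action of `Γ` on the rational function field `K(x_g : g ∈ Γ)` that extends
`h(x_g) = x_{hg}`, trivial on `K`. -/
noncomputable def regularAction (Γ K : Type*) [Group Γ] [Field K] :
    Γ →* (RatFuncField Γ K ≃ₐ[K] RatFuncField Γ K) :=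
  (IsFractionRing.fieldEquivOfAlgEquivHom K (RatFuncField Γ K)).comp (regularPolyAction Γ K)

theorem regularAction_X (Γ K : Type*) [Group Γ] [Field K] (h g : Γ) :
    regularAction Γ K h (algebraMap (MvPolynomial Γ K) (RatFuncField Γ K) (MvPolynomial.X g)) =
      algebraMap (MvPolynomial Γ K) (RatFuncField Γ K) (MvPolynomial.X (h * g)) := by
  simp [regularAction, regularPolyAction]

/-- The fixed field `K(Γ) = K(x_g : g ∈ Γ)^Γ`. -/
noncomputable def noetherField (Γ K : Type*) [Group Γ] [Field K] :
    IntermediateField K (RatFuncField Γ K) :=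
  IntermediateField.fixedField (regularAction Γ K).range

/-- Noether's problem for the group `Γ` has a positive answer over the field `K`. -/
def NoetherProblemPositive (Γ K : Type*) [Group Γ] [Field K] : Prop :=
  IsRationalOver K (noetherField Γ K)

/-- The permutation group `G` contains a subgroup isomorphic to `C_3 × C_3`. -/
def ContainsC3C3 {α : Type*} (G : Subgroup (Equiv.Perm α)) : Prop :=
  ∃ H : Subgroup (Equiv.Perm α), H ≤ G ∧
    Nonempty (H ≃* Multiplicative (ZMod 3) × Multiplicative (ZMod 3))

/-!
Let `E = K(x_g : g ∈ Γ)` and let `F` be a subfield of `E` that is stable under `Γ` and on which `Γ`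
acts faithfully. The span `M` over `F` of `1` and the `x_g` carries a semilinear action of `Γ`, so
by Galois descent (`le_span_invariants`) it has an `F`-basis `1, f₁, …, f_d` of invariant elements,
and a trace argument (`fixed_mem_of_adjoin_eq_top`) gives `E^Γ = F^Γ(f₁, …, f_d)`. If `F^Γ` is
generated by `m` elements and `m + d ≤ |Γ| = trdeg E^Γ`, then these `m + d` generators of `E^Γ` are
algebraically independent, and `E^Γ` is rational (`isRationalOver_fixedField`). No averaging over
`Γ` occurs, so this works in every characteristic.

If `Γ` acts transitively on a finite set `α`, then `E` contains algebraically independent elements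
`y_i`, `i ∈ α`, that are permuted by `Γ` in the same way (`orbitSum`), and the inequality becomes
one about `|α|` (`noetherProblemPositive_of_isPretransitive`).

For the full symmetric group take `F = K(y_i : i ∈ α)`: its fixed field is generated by the
elementary symmetric polynomials (`noetherProblemPositive_perm`).

A transitive group `G ≠ A₆, S₆` of degree six that contains `C₃ × C₃` contains a 3-cycle, so it is
imprimitive by Jordan's theorem, and the support of the 3-cycle is a block
(`exists_block_labelling`). Hence `G` permutes two blocks of size three and contains the rotation of
each of them. Write `z`, `w` for the triples of the `y_i` in the two blocks. For `F` take `K(t, t')`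
with `t = (z₀ - z₁) / (z₁ - z₂)` and `t'` the same expression in `w`. The two rotations have the
fixed field `K(u, v)` in `K(t, t')` (`mem_adjoin_signInv_of_fixed`), where `u ∈ K(t)` has degree
three and is multiplied by the sign of every permutation of its block, and likewise `v ∈ K(t')`. So
`G` acts on `K(u, v)` through signed permutations of `u` and `v`, that is, through a subgroup of the
dihedral group of order eight that exchanges the lines of `u` and `v`; in each of the four possible
cases the fixed field is generated by two explicit elements (`exists_generators_signed_perm`).
Every `y_i` lies in the `F`-span of four of them, and `2 + 4 ≤ 6`.
-/

/-! ### Galois descent for a faithful stable subfield -/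

/-- Linear independence of automorphisms, in dual form: if a finite group acts faithfully on `F`,
then the functions `g ↦ ρ g c` with `c ∈ F` span, over `F`, the indicator function of the
identity. -/
theorem single_one_mem_span_apply {K E Γ : Type*} [Field K] [Field E] [Algebra K E] [Group Γ]
    [DecidableEq Γ] (ρ : Γ →* (E ≃ₐ[K] E)) (F : IntermediateField K E)
    (hF : ∀ g, ∀ x ∈ F, ρ g x ∈ F) (hfaith : ∀ g, (∀ x ∈ F, ρ g x = x) → g = 1) [Finite Γ] :
    (Pi.single 1 1 : Γ → E) ∈ Submodule.span F {φ | ∃ c ∈ F, φ = fun g => ρ g c} := by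
  set A := Submodule.span F {φ : Γ → E | ∃ c ∈ F, φ = fun g => ρ g c} with hA
  -- `A` is stable under multiplication by `g ↦ ρ g a - b` for `a b ∈ F`.
  have hmul : ∀ a ∈ F, ∀ b ∈ F, ∀ φ ∈ A, (fun g => (ρ g a - b) * φ g) ∈ A := by
    intro a ha b hb φ hφ
    induction hφ using Submodule.span_induction with
    | mem φ h =>
      obtain ⟨c, hc, rfl⟩ := h
      have h1 : (fun g => ρ g (a * c)) ∈ A := Submodule.subset_span ⟨_, F.mul_mem ha hc, rfl⟩
      have h2 : (fun g => ρ g c) ∈ A := Submodule.subset_span ⟨_, hc, rfl⟩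
      convert A.sub_mem h1 (A.smul_mem ⟨b, hb⟩ h2) using 1
      ext g
      simp [IntermediateField.smul_def, sub_mul]
    | zero => convert A.zero_mem using 1; ext g; simp
    | add x y _ _ hx hy => convert A.add_mem hx hy using 1; ext g; simp [mul_add]
    | smul r x _ hx =>
      convert A.smul_mem r hx using 1
      ext g
      simp [Algebra.smul_def]
      ring
  -- Multiplying by `(ρ g a - ρ h a) / (a - ρ h a)` adds the zero `h` and keeps the value at `1`.
  have key : ∀ T : Finset Γ, 1 ∉ T → ∃ φ ∈ A, φ 1 = 1 ∧ ∀ g ∈ T, φ g = 0 := by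
    intro T
    induction T using Finset.induction_on with
    | empty => exact fun _ => ⟨_, Submodule.subset_span ⟨1, F.one_mem, rfl⟩, by simp, by simp⟩
    | insert h T _ ih =>
      intro h1
      simp only [Finset.mem_insert, not_or] at h1
      obtain ⟨φ, hφ, hφ1, hφT⟩ := ih h1.2
      obtain ⟨a, ha, hne⟩ : ∃ a ∈ F, ρ h a ≠ a := by
        by_contra! hcon
        exact h1.1 (hfaith h hcon).symm
      have hne' : a - ρ h a ≠ 0 := sub_ne_zero.2 (Ne.symm hne)
      have hmem := A.smul_mem (⟨(a - ρ h a)⁻¹, F.inv_mem (F.sub_mem ha (hF h a ha))⟩ : F)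
        (hmul a ha _ (hF h a ha) φ hφ)
      refine ⟨_, hmem, ?_, ?_⟩
      · simp [Algebra.smul_def, hφ1, hne']
      · intro g hg
        rcases Finset.mem_insert.1 hg with rfl | hg
        · simp
        · simp [hφT g hg]
  have := Fintype.ofFinite Γ
  obtain ⟨φ, hφ, h1, h2⟩ := key (Finset.univ.erase 1) (by simp)
  convert hφ using 1
  ext g
  by_cases hg : g = 1
  · subst hg; simp [h1]
  · simp [hg, h2 g (by simp [hg])]

/-- Galois descent: a `Γ`-stable `F`-subspace of `E` is spanned by its invariant elements. -/
theorem le_span_invariants {K E Γ : Type*} [Field K] [Field E] [Algebra K E] [Group Γ]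
    [Finite Γ] (ρ : Γ →* (E ≃ₐ[K] E)) (F : IntermediateField K E)
    (hF : ∀ g, ∀ x ∈ F, ρ g x ∈ F) (hfaith : ∀ g, (∀ x ∈ F, ρ g x = x) → g = 1)
    (M : Submodule F E) (hM : ∀ g, ∀ m ∈ M, ρ g m ∈ M) :
    M ≤ Submodule.span F {m | m ∈ M ∧ ∀ g, ρ g m = m} := by
  classical
  have := Fintype.ofFinite Γ
  intro m hm
  set I := Submodule.span F {m | m ∈ M ∧ ∀ g, ρ g m = m}
  have key : ∀ φ ∈ Submodule.span F {φ : Γ → E | ∃ c ∈ F, φ = fun g => ρ g c},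
      ∑ g, φ g * ρ g m ∈ I := by
    intro φ hφ
    induction hφ using Submodule.span_induction with
    | mem φ h =>
      obtain ⟨c, hc, rfl⟩ := h
      refine Submodule.subset_span ⟨?_, ?_⟩
      · exact M.sum_mem fun g _ => M.smul_mem (⟨ρ g c, hF g c hc⟩ : F) (hM g m hm)
      · intro h
        rw [map_sum]
        refine Fintype.sum_equiv (Equiv.mulLeft h) _ _ fun g => ?_
        simp
    | zero => simp
    | add x y _ _ hx hy => simpa [add_mul, Finset.sum_add_distrib] using I.add_mem hx hy
    | smul r x _ hx =>
      convert I.smul_mem r hx using 1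
      simp [Algebra.smul_def, Finset.mul_sum, mul_assoc]
  have := key _ (single_one_mem_span_apply ρ F hF hfaith)
  simpa [Pi.single_apply, ite_mul] using this

/-- The trace over `Γ` is not identically zero on `F`, in any characteristic. -/
theorem exists_trace_eq_one {K E Γ : Type*} [Field K] [Field E] [Algebra K E] [Group Γ]
    [Fintype Γ] (ρ : Γ →* (E ≃ₐ[K] E)) (F : IntermediateField K E)
    (hF : ∀ g, ∀ x ∈ F, ρ g x ∈ F) (hfaith : ∀ g, (∀ x ∈ F, ρ g x = x) → g = 1) :
    ∃ c ∈ F, ∑ g, ρ g c = 1 := by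
  classical
  obtain ⟨c, hc, hne⟩ : ∃ c ∈ F, ∑ g, ρ g c ≠ 0 := by
    by_contra! hcon
    have key : ∀ φ ∈ Submodule.span F {φ : Γ → E | ∃ c ∈ F, φ = fun g => ρ g c},
        ∑ g, φ g = 0 := by
      intro φ hφ
      induction hφ using Submodule.span_induction with
      | mem φ h =>
        obtain ⟨c, hc, rfl⟩ := h
        exact hcon c hc
      | zero => simp
      | add x y _ _ hx hy => simp [Finset.sum_add_distrib, hx, hy]
      | smul r x _ hx => simp [← Finset.smul_sum, hx]
    simpa using key _ (single_one_mem_span_apply ρ F hF hfaith)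
  have hinv : ∀ h, ρ h (∑ g, ρ g c) = ∑ g, ρ g c := by
    intro h
    rw [map_sum]
    exact Fintype.sum_equiv (Equiv.mulLeft h) _ _ fun g => by simp
  refine ⟨c * (∑ g, ρ g c)⁻¹, F.mul_mem hc (F.inv_mem (sum_mem fun g _ => hF g c hc)), ?_⟩
  simp only [map_mul, map_inv₀, hinv, ← Finset.sum_mul]
  exact mul_inv_cancel₀ hne

/-- An element `x` of `F` is a root of `∏ g, (X - ρ g x)`, whose coefficients are invariant. -/
theorem isIntegral_of_fixed_mem {K E Γ : Type*} [Field K] [Field E] [Algebra K E] [Group Γ]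
    [Finite Γ] (ρ : Γ →* (E ≃ₐ[K] E)) (F : IntermediateField K E)
    (hF : ∀ g, ∀ x ∈ F, ρ g x ∈ F) (L : IntermediateField K E)
    (hFL : ∀ x ∈ F, (∀ g, ρ g x = x) → x ∈ L) (x : E) (hx : x ∈ F) : IsIntegral L x := by
  have := Fintype.ofFinite Γ
  set p : Polynomial F := ∏ g, (Polynomial.X - Polynomial.C ⟨ρ g x, hF g x hx⟩)
  set P : Polynomial E := ∏ g, (Polynomial.X - Polynomial.C (ρ g x)) with hP
  have hpP : p.map (algebraMap F E) = P := by
    simp [p, P, Polynomial.map_prod]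
  have hPinv : ∀ h, P.map (ρ h : E →+* E) = P := by
    intro h
    rw [hP, Polynomial.map_prod]
    exact Fintype.prod_equiv (Equiv.mulLeft h) _ _ fun g => by simp
  have hPL : P ∈ Polynomial.lifts (algebraMap L E) := by
    rw [Polynomial.lifts_iff_coeff_lifts]
    intro n
    refine ⟨⟨P.coeff n, hFL _ ?_ fun h => ?_⟩, rfl⟩
    · rw [← hpP, Polynomial.coeff_map]
      exact (p.coeff n).2
    · conv_rhs => rw [← hPinv h]
      simp [Polynomial.coeff_map]
  obtain ⟨q, hq, -, hqm⟩ := Polynomial.lifts_and_natDegree_eq_and_monic hPL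
    (Polynomial.monic_prod_of_monic _ _ fun g _ => Polynomial.monic_X_sub_C _)
  refine ⟨q, hqm, ?_⟩
  rw [Polynomial.eval₂_eq_eval_map, hq, hP, Polynomial.eval_prod]
  exact Finset.prod_eq_zero (Finset.mem_univ 1) (by simp)

/-- If `E = L(F)` for a field `L` of invariant elements that contains the invariants of `F`, then `L`
contains all invariants of `E`: for `c ∈ F` of trace one, an invariant `e` is the trace of `c * e`,
and `E` is spanned by `F` over `L`. -/
theorem fixed_mem_of_adjoin_eq_top {K E Γ : Type*} [Field K] [Field E] [Algebra K E] [Group Γ]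
    [Finite Γ] (ρ : Γ →* (E ≃ₐ[K] E)) (F : IntermediateField K E)
    (hF : ∀ g, ∀ x ∈ F, ρ g x ∈ F) (hfaith : ∀ g, (∀ x ∈ F, ρ g x = x) → g = 1)
    (L : IntermediateField K E) (hL : ∀ g, ∀ x ∈ L, ρ g x = x)
    (hFL : ∀ x ∈ F, (∀ g, ρ g x = x) → x ∈ L)
    (htop : IntermediateField.adjoin L (F : Set E) = ⊤) (e : E) (he : ∀ g, ρ g e = e) :
    e ∈ L := by
  have := Fintype.ofFinite Γ
  have halg : ∀ x ∈ (F : Set E), IsIntegral L x := by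
    exact fun x hx => isIntegral_of_fixed_mem ρ F hF L hFL x hx
  -- `F` is closed under multiplication and algebraic over `L`.
  have hspan : Submodule.span L (F : Set E) = ⊤ := by
    have h1 := IntermediateField.adjoin_toSubalgebra_of_isAlgebraic fun x hx =>
      (halg x hx).isAlgebraic
    have h2 := Algebra.adjoin_eq_span L (F : Set E)
    have h3 : Submonoid.closure (F : Set E) = F.toSubalgebra.toSubmonoid :=
      Submonoid.closure_eq F.toSubalgebra.toSubmonoid
    rw [h3, ← h1, htop] at h2
    simpa using h2.symm
  obtain ⟨c, hc, hc1⟩ := exists_trace_eq_one ρ F hF hfaith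
  have key : ∀ y ∈ Submodule.span L (F : Set E), ∑ g, ρ g y ∈ L := by
    intro y hy
    induction hy using Submodule.span_induction with
    | mem y hy =>
      refine hFL _ (sum_mem fun g _ => hF g y hy) fun h => ?_
      rw [map_sum]
      exact Fintype.sum_equiv (Equiv.mulLeft h) _ _ fun g => by simp
    | zero => simp
    | add x y _ _ hx hy => simpa [Finset.sum_add_distrib] using L.add_mem hx hy
    | smul r x _ hx =>
      convert L.mul_mem r.2 hx using 1
      simp [Algebra.smul_def, Finset.mul_sum, hL _ _ r.2]
  have := key (c * e) (by simp [hspan])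
  simpa [he, ← Finset.sum_mul, hc1] using this

/-- Let `t` be a root of a nonzero polynomial over `L` of degree at most `n`, and let `n`
automorphisms over `L` map `t` to distinct elements. Then an element of `L(t)` that is fixed by all
of them lies in `L`. -/
theorem mem_of_fixed_of_root {K E ι : Type*} [Field K] [Field E] [Algebra K E] [Fintype ι]
    [Nonempty ι] (s : ι → (E ≃ₐ[K] E)) (L : IntermediateField K E) (hs : ∀ i, ∀ x ∈ L, s i x = x) (t : E)
    (hst : Function.Injective fun i => s i t) (p : Polynomial L) (hp : p ≠ 0)
    (hdeg : p.natDegree ≤ Fintype.card ι) (hroot : Polynomial.aeval t p = 0)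
    (e : E) (he : e ∈ IntermediateField.adjoin L {t}) (hse : ∀ i, s i e = e) : e ∈ L := by
  have htint : IsIntegral L t := isAlgebraic_iff_isIntegral.1 ⟨p, hp, hroot⟩
  have he' : e ∈ Algebra.adjoin L {t} := by
    rwa [← IntermediateField.adjoin_simple_toSubalgebra_of_isAlgebraic htint.isAlgebraic]
  obtain ⟨q, rfl⟩ := Algebra.adjoin_mem_exists_aeval L t he'
  have hm := minpoly.monic htint
  -- `e = r(t)` with `deg r < n`, while `r - e` has the `n` distinct roots `s i t`.
  set r := q %ₘ minpoly L t with hr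
  have hrt : Polynomial.aeval t r = Polynomial.aeval t q :=
    Polynomial.aeval_modByMonic_eq_self_of_root (minpoly.aeval L t)
  rw [← hrt] at hse ⊢
  have hdegr : r.degree < Fintype.card ι :=
    (Polynomial.degree_modByMonic_lt q hm).trans_le <| by
      rw [Polynomial.degree_eq_natDegree hm.ne_zero]
      exact_mod_cast (Polynomial.natDegree_le_of_dvd (minpoly.dvd L t hroot) hp).trans hdeg
  have hpos : 0 < Fintype.card ι := Fintype.card_pos
  set R : Polynomial E := r.map (algebraMap L E) - Polynomial.C (Polynomial.aeval t r) with hR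
  have hRdeg : R.degree < Fintype.card ι := by
    refine (Polynomial.degree_sub_le _ _).trans_lt (max_lt ?_ ?_)
    · exact (Polynomial.degree_map_le).trans_lt hdegr
    · exact Polynomial.degree_C_le.trans_lt (by exact_mod_cast hpos)
  have hRroot : ∀ i, R.eval (s i t) = 0 := by
    intro i
    have h1 : Polynomial.eval (s i t) (r.map (algebraMap L E)) = s i (Polynomial.aeval t r) := by
      have h2 : (s i : E →+* E).comp (algebraMap L E) = algebraMap L E := by
        ext x
        exact hs i x x.2
      rw [Polynomial.eval_map, Polynomial.aeval_def]
      exact (h2 ▸ Polynomial.hom_eval₂ r (algebraMap L E) (s i : E →+* E) t).symm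
    rw [hR, Polynomial.eval_sub, h1, hse i]
    simp
  have hR0 : R = 0 := by
    refine Polynomial.eq_zero_of_degree_lt_of_eval_index_eq_zero (s := Finset.univ)
      (v := fun i => s i t) hst.injOn ?_ fun i _ => hRroot i
    rwa [Finset.card_univ]
  have h0 : R.coeff 0 = 0 := by simp [hR0]
  rw [hR, Polynomial.coeff_sub, Polynomial.coeff_C_zero, Polynomial.coeff_map, sub_eq_zero] at h0
  rw [← h0]
  exact (r.coeff 0).2

/-! ### The rationality criterion -/

/-- If `E` is algebraic over `N` and `N` is generated over `K` by at most `trdeg K E` elements, then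
these are algebraically independent. -/
theorem isRationalOver_of_card_le_trdeg {K E : Type*} [Field K] [Field E] [Algebra K E]
    (N : IntermediateField K E) [Algebra.IsAlgebraic N E] (T : Set E) [Finite T]
    (hT : N = IntermediateField.adjoin K T) (hcard : (Nat.card T : Cardinal) ≤ Algebra.trdeg K E) :
    IsRationalOver K N := by
  have hTN : T ⊆ N := hT ▸ IntermediateField.subset_adjoin K T
  set T' : Set N := (↑) ⁻¹' T with hT'
  have himg : (Subtype.val '' T' : Set E) = T := by
    simpa [hT', Set.image_preimage_eq_inter_range] using hTN
  have htop : IntermediateField.adjoin K T' = ⊤ := by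
    apply IntermediateField.map_injective N.val
    rw [IntermediateField.adjoin_map]
    have : N.val '' T' = T := himg
    rw [this, ← hT, ← AlgHom.fieldRange_eq_map, IntermediateField.fieldRange_val]
  refine ⟨T', ?_, htop⟩
  have : Finite T' := Set.Finite.preimage Subtype.val_injective.injOn ‹Finite T›
  have hc : Nat.card T' = Nat.card T := by
    rw [← himg, Nat.card_image_of_injective Subtype.val_injective]
  have halg : Algebra.IsAlgebraic
      (Algebra.adjoin K (Set.range (Subtype.val : T' → N))) N := by
    rw [Subtype.range_coe]
    refine ⟨fun a => ?_⟩
    have ha : a ∈ IntermediateField.adjoin K T' := htop ▸ IntermediateField.mem_top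
    obtain ⟨r, hr, s, hs, rfl⟩ := IntermediateField.mem_adjoin_iff_div.1 ha
    rw [div_eq_mul_inv]
    exact (isAlgebraic_algebraMap (A := N) (⟨r, hr⟩ : Algebra.adjoin K T')).mul
      (isAlgebraic_algebraMap (A := N) (⟨s, hs⟩ : Algebra.adjoin K T')).inv
  refine (Algebra.IsAlgebraic.isTranscendenceBasis_of_lift_le_trdeg_of_finite K _ ?_).1
  rw [Cardinal.lift_id, Cardinal.lift_id, ← Nat.cast_card, hc]
  have h := trdeg_add_eq K N (A := E)
  rw [trdeg_eq_zero (R := N), add_zero] at h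
  rwa [h]

theorem adjoin_range_X {σ K : Type*} [Field K] :
    IntermediateField.adjoin K (Set.range fun i : σ =>
      algebraMap (MvPolynomial σ K) (RatFuncField σ K) (MvPolynomial.X i)) = ⊤ := by
  rw [eq_top_iff]
  intro e _
  set Z := IntermediateField.adjoin K (Set.range fun i : σ =>
      algebraMap (MvPolynomial σ K) (RatFuncField σ K) (MvPolynomial.X i))
  have hpoly : ∀ p : MvPolynomial σ K, algebraMap _ (RatFuncField σ K) p ∈ Z := by
    intro p
    induction p using MvPolynomial.induction_on with
    | C a => exact Z.algebraMap_mem a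
    | add p q hp hq => rw [map_add]; exact Z.add_mem hp hq
    | mul_X p i hp =>
      rw [map_mul]
      exact Z.mul_mem hp (IntermediateField.subset_adjoin _ _ ⟨i, rfl⟩)
  obtain ⟨p, q, -, rfl⟩ := IsFractionRing.div_surjective (A := MvPolynomial σ K) e
  exact Z.div_mem (hpoly p) (hpoly q)

/-- The rationality criterion for a regular action: `P` generates the fixed field of `F`, and `1`
together with `W` spans over `F` a space that contains all `x g`. -/
theorem isRationalOver_fixedField {K E Γ : Type*} [Field K] [Field E] [Algebra K E] [Group Γ]
    [Finite Γ] (ρ : Γ →* (E ≃ₐ[K] E)) (x : Γ → E) (hx : AlgebraicIndependent K x)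
    (hgen : IntermediateField.adjoin K (Set.range x) = ⊤) (hρ : ∀ g h, ρ g (x h) = x (g * h))
    (F : IntermediateField K E) (hF : ∀ g, ∀ x ∈ F, ρ g x ∈ F)
    (hfaith : ∀ g, (∀ x ∈ F, ρ g x = x) → g = 1)
    (P W : Finset E) (hPF : ∀ x ∈ P, ∀ g, ρ g x = x)
    (hP : ∀ x ∈ F, (∀ g, ρ g x = x) → x ∈ IntermediateField.adjoin K (P : Set E))
    (hW : ∀ g, x g ∈ Submodule.span F (insert 1 (W : Set E)))
    (hcard : P.card + W.card ≤ Nat.card Γ) :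
    IsRationalOver K (IntermediateField.fixedField ρ.range) := by
  classical
  set M : Submodule F E := Submodule.span F (insert 1 (Set.range x)) with hMdef
  have h1M : (1 : E) ∈ M := Submodule.subset_span (Set.mem_insert _ _)
  have hxM : ∀ g, x g ∈ M := fun g => Submodule.subset_span (Set.mem_insert_of_mem _ ⟨g, rfl⟩)
  have hM : ∀ g, ∀ m ∈ M, ρ g m ∈ M := by
    intro g m hm
    induction hm using Submodule.span_induction with
    | mem y hy =>
      rcases hy with rfl | ⟨h, rfl⟩
      · simpa using h1M
      · simpa [hρ] using hxM (g * h)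
    | zero => simp
    | add y z _ _ hy hz => simpa using M.add_mem hy hz
    | smul r y _ hy =>
      convert M.smul_mem (⟨ρ g r, hF g r r.2⟩ : F) hy using 1
      simp [IntermediateField.smul_def]
  have hMW : M ≤ Submodule.span F (insert 1 (W : Set E)) := by
    refine Submodule.span_le.2 (Set.insert_subset (Submodule.subset_span (Set.mem_insert _ _)) ?_)
    rintro _ ⟨g, rfl⟩
    exact hW g
  obtain ⟨b, hbI, h1b, hspan, hli⟩ := exists_linearIndepOn_extension (K := F) (v := (id : E → E))
    (s := {1}) (t := {m | m ∈ M ∧ ∀ g, ρ g m = m})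
    (LinearIndepOn.singleton one_ne_zero)
    (by simpa using h1M)
  simp only [Set.image_id] at hspan
  have hMb : M ≤ Submodule.span F b :=
    (le_span_invariants ρ F hF hfaith M hM).trans (Submodule.span_le.2 hspan)
  have hbW : Submodule.span F b ≤ Submodule.span F ((insert 1 W : Finset E) : Set E) := by
    rw [Submodule.span_le]
    intro m hm
    simpa using hMW (hbI hm).1
  have hbcard0 : Cardinal.mk b ≤ (insert 1 W : Finset E).card := by
    rw [← rank_span_set hli]
    exact (Submodule.rank_mono hbW).trans (rank_span_finset_le _)
  have hbfin : b.Finite := Cardinal.lt_aleph0_iff_set_finite.1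
    (hbcard0.trans_lt Cardinal.natCast_lt_aleph0)
  have hbcard : b.ncard ≤ W.card + 1 := by
    have : (b.ncard : Cardinal) ≤ (insert 1 W : Finset E).card := by
      rwa [Set.cast_ncard hbfin]
    exact (by exact_mod_cast this : b.ncard ≤ _).trans (Finset.card_insert_le _ _)
  -- The basis element `1` is not needed as a generator, which saves the one in `hbcard`.
  set T : Set E := P ∪ (b \ {1})
  have hTfin : T.Finite := P.finite_toSet.union (hbfin.subset Set.sdiff_subset)
  have hTcard : T.ncard ≤ Nat.card Γ := by
    refine (Set.ncard_union_le _ _).trans ?_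
    rw [Set.ncard_coe_finset, Set.ncard_sdiff_singleton_of_mem (by simpa using h1b)]
    omega
  set N := IntermediateField.fixedField ρ.range
  have hTN : IntermediateField.adjoin K T ≤ N := by
    rw [IntermediateField.adjoin_le_iff]
    rintro y hy ⟨_, ⟨g, rfl⟩⟩
    rcases hy with hy | hy
    · exact hPF y hy g
    · exact (hbI hy.1).2 g
  have hmemN : ∀ y, y ∈ N ↔ ∀ g, ρ g y = y := by
    intro y
    exact ⟨fun h g => h ⟨_, ⟨g, rfl⟩⟩, by rintro h ⟨_, ⟨g, rfl⟩⟩; exact h g⟩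
  have hEtop : IntermediateField.adjoin (IntermediateField.adjoin K T) (F : Set E) = ⊤ := by
    set Z := IntermediateField.adjoin (IntermediateField.adjoin K T) (F : Set E)
    have hFZ : (F : Set E) ⊆ Z := IntermediateField.subset_adjoin _ _
    have hTZ : T ⊆ Z := fun y hy =>
      Z.algebraMap_mem (⟨y, IntermediateField.subset_adjoin K T hy⟩ : IntermediateField.adjoin K T)
    have hbZ : b ⊆ Z := by
      intro y hy
      by_cases h : y = 1
      · exact h ▸ Z.one_mem
      · exact hTZ (Or.inr ⟨hy, h⟩)
    have hMZ : ∀ m ∈ M, m ∈ Z := by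
      intro m hm
      replace hm := hMb hm
      induction hm using Submodule.span_induction with
      | mem y hy => exact hbZ hy
      | zero => exact Z.zero_mem
      | add y z _ _ hy hz => exact Z.add_mem hy hz
      | smul r y _ hy => exact Z.mul_mem (hFZ r.2) hy
    rw [eq_top_iff]
    intro y _
    have hy : y ∈ IntermediateField.adjoin K (Set.range x) := hgen ▸ IntermediateField.mem_top
    have hle : IntermediateField.adjoin K (Set.range x) ≤ Z.restrictScalars K := by
      rw [IntermediateField.adjoin_le_iff]
      rintro _ ⟨g, rfl⟩
      exact hMZ _ (hxM g)
    exact hle hy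
  have hN : N = IntermediateField.adjoin K T := by
    refine le_antisymm (fun e he => ?_) hTN
    refine fixed_mem_of_adjoin_eq_top ρ F hF hfaith _ (fun g y hy => (hmemN y).1 (hTN hy) g)
      (fun y hy hfix => ?_) hEtop e ((hmemN e).1 he)
    exact IntermediateField.adjoin.mono K _ _ Set.subset_union_left (hP y hy hfix)
  have hNalg : Algebra.IsAlgebraic N E := ⟨fun y =>
    (isIntegral_of_fixed_mem ρ ⊤ (fun _ _ _ => IntermediateField.mem_top) N
      (fun z _ hz => (hmemN z).2 hz) y IntermediateField.mem_top).isAlgebraic⟩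
  have : Finite T := hTfin
  refine isRationalOver_of_card_le_trdeg N T hN ?_
  have h1 := hx.lift_cardinalMk_le_trdeg
  rw [← Nat.cast_card, Cardinal.lift_natCast] at h1
  have h2 : ((Nat.card T : ℕ) : Cardinal) ≤ (Nat.card Γ : ℕ) := by exact_mod_cast hTcard
  refine h2.trans ?_
  simpa using h1

/-! ### Transitive actions -/

universe u v

/-- The sum of the `x g` over all `g` that map the base point `i₀` to `i`. For a transitive action
these sums embed the permutation module on `α` into the regular one. -/
noncomputable def orbitSum {Γ α E : Type*} [Group Γ] [Fintype Γ] [MulAction Γ α] [DecidableEq α]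
    [AddCommMonoid E] (x : Γ → E) (i₀ i : α) : E :=
  ∑ g with g • i₀ = i, x g

theorem map_orbitSum {K Γ α E : Type*} [Field K] [Field E] [Algebra K E] [Group Γ] [Fintype Γ]
    [MulAction Γ α] [DecidableEq α] (ρ : Γ →* (E ≃ₐ[K] E)) (x : Γ → E)
    (hρ : ∀ g h, ρ g (x h) = x (g * h)) (i₀ i : α) (g : Γ) :
    ρ g (orbitSum x i₀ i) = orbitSum x i₀ (g • i) := by
  simp only [orbitSum, map_sum, hρ]
  refine Finset.sum_equiv (Equiv.mulLeft g) (fun h => ?_) fun _ _ => rfl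
  simp [mul_smul]

theorem algebraicIndependent_orbitSum {K Γ α E : Type*} [Field K] [Field E] [Algebra K E]
    [Group Γ] [Fintype Γ] [MulAction Γ α] [MulAction.IsPretransitive Γ α] [DecidableEq α]
    (x : Γ → E) (hx : AlgebraicIndependent K x) (i₀ : α) :
    AlgebraicIndependent K (orbitSum x i₀) := by
  classical
  -- The map `x_g ↦ X_i` if `g` is the chosen representative of `i = g i₀`, and `x_g ↦ 0`
  -- otherwise, is a left inverse of `X_i ↦ y_i`.
  choose r hr using fun i : α => MulAction.exists_smul_eq Γ i₀ i
  have hcomp : Function.Injective (MvPolynomial.aeval (R := K)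
      (orbitSum (MvPolynomial.X : Γ → MvPolynomial Γ K) i₀)) := by
    refine Function.HasLeftInverse.injective ⟨MvPolynomial.aeval (R := K)
      fun g => if g = r (g • i₀) then (MvPolynomial.X (g • i₀) : MvPolynomial α K) else 0, ?_⟩
    intro p
    rw [← AlgHom.comp_apply]
    suffices h : (MvPolynomial.aeval (R := K) fun g : Γ => if g = r (g • i₀) then
        (MvPolynomial.X (g • i₀) : MvPolynomial α K) else 0).comp (MvPolynomial.aeval
        (orbitSum (MvPolynomial.X : Γ → MvPolynomial Γ K) i₀)) = AlgHom.id K _ by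
      rw [h]; rfl
    ext1 i
    simp only [orbitSum, AlgHom.comp_apply, MvPolynomial.aeval_X, map_sum, AlgHom.id_apply]
    rw [Finset.sum_eq_single (r i)]
    · simp [hr]
    · intro g hg hne
      rw [if_neg]
      rwa [(Finset.mem_filter.1 hg).2]
    · simp [hr]
  have hfac : MvPolynomial.aeval (R := K) (orbitSum x i₀) = (MvPolynomial.aeval x).comp
      (MvPolynomial.aeval (orbitSum (MvPolynomial.X : Γ → MvPolynomial Γ K) i₀)) := by
    ext1 i
    simp [orbitSum]
  rw [AlgebraicIndependent, hfac, AlgHom.coe_comp]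
  exact Function.Injective.comp hx hcomp

/-- The criterion `isRationalOver_fixedField` with `W` enlarged by the `x g` for `g` outside a set of
representatives of the elements of `α`: the remaining `x g` are recovered from the orbit sums. -/
theorem isRationalOver_fixedField_of_isPretransitive {K E Γ α : Type*} [Field K] [Field E]
    [Algebra K E] [Group Γ] [Fintype Γ] [Fintype α] [DecidableEq α] [MulAction Γ α]
    [MulAction.IsPretransitive Γ α] (ρ : Γ →* (E ≃ₐ[K] E)) (x : Γ → E)
    (hx : AlgebraicIndependent K x) (hgen : IntermediateField.adjoin K (Set.range x) = ⊤)
    (hρ : ∀ g h, ρ g (x h) = x (g * h)) (i₀ : α)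
    (F : IntermediateField K E) (hF : ∀ g, ∀ x ∈ F, ρ g x ∈ F)
    (hfaith : ∀ g, (∀ x ∈ F, ρ g x = x) → g = 1)
    (P W : Finset E) (hPF : ∀ x ∈ P, ∀ g, ρ g x = x)
    (hP : ∀ x ∈ F, (∀ g, ρ g x = x) → x ∈ IntermediateField.adjoin K (P : Set E))
    (hW : ∀ i, orbitSum x i₀ i ∈ Submodule.span F (insert 1 (W : Set E)))
    (hcard : P.card + W.card ≤ Fintype.card α) :
    IsRationalOver K (IntermediateField.fixedField ρ.range) := by
  classical
  choose r hr using fun i : α => MulAction.exists_smul_eq Γ i₀ i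
  have hrinj : Function.Injective r := fun i j h => by rw [← hr i, h, hr]
  set R : Finset Γ := Finset.univ.image r
  have hRcard : R.card = Fintype.card α := Finset.card_image_of_injective _ hrinj
  set S := Submodule.span F (insert 1 ((W ∪ (Finset.univ \ R).image x : Finset E) : Set E))
  have hyS : ∀ i, orbitSum x i₀ i ∈ S := fun i =>
    Submodule.span_mono (Set.insert_subset_insert (by simp)) (hW i)
  have hxS : ∀ g, g ∉ R → x g ∈ S := fun g hg =>
    Submodule.subset_span (Set.mem_insert_of_mem _ (by simp; exact Or.inr ⟨g, hg, rfl⟩))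
  refine isRationalOver_fixedField ρ x hx hgen hρ F hF hfaith P
    (W ∪ (Finset.univ \ R).image x) hPF hP (fun g => ?_) ?_
  · by_cases hg : g ∈ R
    · obtain ⟨i, -, rfl⟩ := Finset.mem_image.1 hg
      have h1 : orbitSum x i₀ i =
          x (r i) + ∑ g ∈ (Finset.univ.filter fun g : Γ => g • i₀ = i).erase (r i), x g := by
        rw [orbitSum, Finset.add_sum_erase _ _ (by simp [hr])]
      rw [← sub_eq_iff_eq_add] at h1
      change x (r i) ∈ S
      rw [← h1]
      refine S.sub_mem (hyS i) (S.sum_mem fun g hg => hxS g fun hgR => ?_)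
      obtain ⟨j, -, rfl⟩ := Finset.mem_image.1 hgR
      simp [hr] at hg
      exact hg.1 (by rw [hg.2])
    · exact hxS g hg
  · have h1 := Finset.card_union_le W ((Finset.univ \ R).image x)
    have h2 := Finset.card_image_le (s := Finset.univ \ R) (f := x)
    have h3 := Finset.card_sdiff_add_card_eq_card (Finset.subset_univ R)
    rw [Finset.card_univ] at h3
    rw [Nat.card_eq_fintype_card]
    omega

/-- To solve Noether's problem for a group that acts transitively on `α`, it suffices to find `F`,
generators `P` of its fixed field, and `W` that together with `1` spans the `y i` over `F`, such that
`|P| + |W| ≤ |α|`. Faithfulness on `F` makes the action on `α` faithful. -/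
theorem noetherProblemPositive_of_isPretransitive {K : Type u} {Γ : Type v} {α : Type*} [Field K]
    [Group Γ] [Finite Γ] [Fintype α] [Nonempty α] [MulAction Γ α] [MulAction.IsPretransitive Γ α]
    (H : ∀ {E : Type (max v u)} [Field E] [Algebra K E] (ρ : Γ →* (E ≃ₐ[K] E)) (y : α → E),
      AlgebraicIndependent K y → (∀ g i, ρ g (y i) = y (g • i)) →
      ∃ (F : IntermediateField K E) (P W : Finset E),
        (∀ g, ∀ x ∈ F, ρ g x ∈ F) ∧ (∀ g, (∀ x ∈ F, ρ g x = x) → g = 1) ∧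
        (∀ x ∈ P, ∀ g, ρ g x = x) ∧
        (∀ x ∈ F, (∀ g, ρ g x = x) → x ∈ IntermediateField.adjoin K (P : Set E)) ∧
        (∀ i, y i ∈ Submodule.span F (insert 1 (W : Set E))) ∧
        P.card + W.card ≤ Fintype.card α) :
    NoetherProblemPositive Γ K := by
  classical
  have := Fintype.ofFinite Γ
  have hxi : AlgebraicIndependent K fun g : Γ =>
      algebraMap (MvPolynomial Γ K) (RatFuncField Γ K) (MvPolynomial.X g) :=
    (MvPolynomial.algebraicIndependent_X Γ K).map' (f := IsScalarTower.toAlgHom K _ _)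
      (IsFractionRing.injective (MvPolynomial Γ K) (RatFuncField Γ K))
  inhabit α
  obtain ⟨F, P, W, hF, hfaith, hPF, hP, hW, hcard⟩ := H (regularAction Γ K)
    (orbitSum _ default) (algebraicIndependent_orbitSum _ hxi default)
    (fun g i => map_orbitSum _ _ (regularAction_X Γ K) _ i g)
  exact isRationalOver_fixedField_of_isPretransitive _ _ hxi adjoin_range_X (regularAction_X Γ K)
    default F hF hfaith P W hPF hP hW hcard

/-! ### The symmetric group -/

theorem map_mem_adjoin {K E : Type*} [Field K] [Field E] [Algebra K E] {s : Set E}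
    {L : IntermediateField K E} (f : E ≃ₐ[K] E) (hs : ∀ x ∈ s, f x ∈ L) {x : E}
    (hx : x ∈ IntermediateField.adjoin K s) : f x ∈ L := by
  have hle : IntermediateField.adjoin K s ≤ L.comap (f : E →ₐ[K] E) :=
    IntermediateField.adjoin_le_iff.2 hs
  exact hle hx

theorem map_eq_self_of_mem_adjoin {K E : Type*} [Field K] [Field E] [Algebra K E] {s : Set E}
    (f : E ≃ₐ[K] E) (hs : ∀ x ∈ s, f x = x) {x : E}
    (hx : x ∈ IntermediateField.adjoin K s) : f x = x := by
  induction hx using IntermediateField.adjoin_induction with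
  | mem y hy => exact hs y hy
  | algebraMap a => exact f.commutes a
  | add y z _ _ hy hz => rw [map_add, hy, hz]
  | inv y _ hy => rw [map_inv₀, hy]
  | mul y z _ _ hy hz => rw [map_mul, hy, hz]

theorem aeval_mem_adjoin_esymm {K E α : Type*} [Field K] [Field E] [Algebra K E] [Fintype α]
    (y : α → E) (p : MvPolynomial α K) (hp : p.IsSymmetric) :
    MvPolynomial.aeval y p ∈ IntermediateField.adjoin K (Set.range fun i : Fin (Fintype.card α) =>
      MvPolynomial.aeval y (MvPolynomial.esymm α K (i + 1))) := by
  obtain ⟨q, hq⟩ := MvPolynomial.esymmAlgHom_surjective (σ := α) K le_rfl ⟨p, hp⟩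
  have hq' : p = MvPolynomial.aeval (fun i : Fin (Fintype.card α) =>
      MvPolynomial.esymm α K (i + 1)) q := by
    rw [← MvPolynomial.esymmAlgHom_apply, hq]
  rw [hq', ← AlgHom.comp_apply, MvPolynomial.comp_aeval]
  apply IntermediateField.algebra_adjoin_le_adjoin
  rw [Algebra.adjoin_range_eq_range_aeval]
  exact ⟨q, rfl⟩

theorem map_aeval_perm {K E α : Type*} [Field K] [Field E] [Algebra K E]
    (ρ : Equiv.Perm α →* (E ≃ₐ[K] E)) (y : α → E) (hρ : ∀ g i, ρ g (y i) = y (g i))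
    (g : Equiv.Perm α) (p : MvPolynomial α K) :
    ρ g (MvPolynomial.aeval y p) = MvPolynomial.aeval y (MvPolynomial.rename g p) := by
  rw [MvPolynomial.aeval_rename]
  have : ((ρ g : E →ₐ[K] E).comp (MvPolynomial.aeval y)) = MvPolynomial.aeval (y ∘ g) := by
    ext i
    simp [hρ]
  exact DFunLike.congr_fun this p

/-- The symmetric rational functions are generated by the elementary symmetric polynomials. -/
theorem mem_adjoin_esymm_of_fixed {K E α : Type*} [Field K] [Field E] [Algebra K E] [Fintype α]
    (ρ : Equiv.Perm α →* (E ≃ₐ[K] E)) (y : α → E) (hy : AlgebraicIndependent K y)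
    (hρ : ∀ g i, ρ g (y i) = y (g i)) (e : E) (he : e ∈ IntermediateField.adjoin K (Set.range y))
    (hfix : ∀ g, ρ g e = e) :
    e ∈ IntermediateField.adjoin K (Set.range fun i : Fin (Fintype.card α) =>
      MvPolynomial.aeval y (MvPolynomial.esymm α K (i + 1))) := by
  classical
  obtain ⟨p, q, rfl⟩ := (IntermediateField.mem_adjoin_range_iff K y e).1 he
  by_cases hq : q = 0
  · simp [hq]
  -- Multiply numerator and denominator by the conjugates of `q`.
  set Q : MvPolynomial α K := ∏ g : Equiv.Perm α, MvPolynomial.rename g q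
  set q' : MvPolynomial α K := ∏ g ∈ Finset.univ.erase (1 : Equiv.Perm α), MvPolynomial.rename g q
  have hQ : Q = q * q' := by
    have h := Finset.mul_prod_erase Finset.univ
      (fun g : Equiv.Perm α => MvPolynomial.rename g q) (Finset.mem_univ 1)
    simpa using h.symm
  have hQ0 : Q ≠ 0 := Finset.prod_ne_zero_iff.2 fun g _ =>
    (map_ne_zero_iff _ (MvPolynomial.rename_injective _ g.injective)).2 hq
  have hinj : Function.Injective (MvPolynomial.aeval (R := K) y) := hy
  have hQsymm : Q.IsSymmetric := by
    intro g
    rw [map_prod]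
    exact Fintype.prod_equiv (Equiv.mulLeft g) _ _ fun h => by
      simp [MvPolynomial.rename_rename, Function.comp_def]
  have hQy : MvPolynomial.aeval y Q ≠ 0 := (map_ne_zero_iff _ hinj).2 hQ0
  have hqy : MvPolynomial.aeval y q' ≠ 0 :=
    (map_ne_zero_iff _ hinj).2 (right_ne_zero_of_mul (hQ ▸ hQ0))
  have heq : MvPolynomial.aeval y p / MvPolynomial.aeval y q =
      MvPolynomial.aeval y (p * q') / MvPolynomial.aeval y Q := by
    rw [hQ, map_mul, map_mul, mul_div_mul_right _ _ hqy]
  have hpsymm : (p * q').IsSymmetric := by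
    intro g
    apply hinj
    have h1 := hfix g
    rw [heq, map_div₀, map_aeval_perm ρ y hρ, map_aeval_perm ρ y hρ, hQsymm g] at h1
    exact (div_left_inj' hQy).1 h1
  rw [heq]
  exact div_mem (aeval_mem_adjoin_esymm y _ hpsymm) (aeval_mem_adjoin_esymm y _ hQsymm)

/-- Noether's problem for a full symmetric group has a positive answer over every field. -/
theorem noetherProblemPositive_perm (K : Type u) [Field K] (α : Type v) [Fintype α] [Nonempty α] :
    NoetherProblemPositive (Equiv.Perm α) K := by
  classical
  refine noetherProblemPositive_of_isPretransitive (α := α) fun {E} _ _ ρ y hy hρ => ?_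
  have hyF : ∀ i, y i ∈ IntermediateField.adjoin K (Set.range y) := fun i =>
    IntermediateField.subset_adjoin K _ ⟨i, rfl⟩
  refine ⟨IntermediateField.adjoin K (Set.range y), Finset.univ.image
    fun i : Fin (Fintype.card α) => MvPolynomial.aeval y (MvPolynomial.esymm α K (i + 1)), ∅,
    fun g x hx => ?_, fun g hg => ?_, ?_, ?_, fun i => ?_, ?_⟩
  · refine map_mem_adjoin (ρ g) ?_ hx
    rintro _ ⟨i, rfl⟩
    rw [hρ]
    exact hyF _
  · ext i
    exact hy.injective (by simpa [hρ] using hg _ (hyF i))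
  · intro x hx g
    obtain ⟨i, -, rfl⟩ := Finset.mem_image.1 hx
    rw [map_aeval_perm ρ y hρ, MvPolynomial.esymm_isSymmetric]
  · intro x hx hfix
    simpa using mem_adjoin_esymm_of_fixed ρ y hy hρ x hx hfix
  · rw [Finset.coe_empty, insert_empty_eq, Submodule.mem_span_singleton]
    exact ⟨⟨y i, hyF i⟩, by simp [IntermediateField.smul_def]⟩
  · simpa using Finset.card_image_le (s := Finset.univ)
      (f := fun i : Fin (Fintype.card α) => MvPolynomial.aeval y (MvPolynomial.esymm α K (i + 1)))

/-! ### Signed permutations of two elements -/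

/-- The form of `mem_of_fixed_of_root` for fields given by generators: `L = K(S')` and
`K(S) ⊆ L(t)`. -/
theorem mem_adjoin_of_fixed_of_root {K E ι : Type*} [Field K] [Field E] [Algebra K E] [Fintype ι]
    [Nonempty ι] (s : ι → (E ≃ₐ[K] E)) {S S' : Set E} {t : E} (hs : ∀ i, ∀ x ∈ S', s i x = x)
    (hst : Function.Injective fun i => s i t) (p : Polynomial (IntermediateField.adjoin K S'))
    (hp : p ≠ 0) (hdeg : p.natDegree ≤ Fintype.card ι) (hroot : Polynomial.aeval t p = 0)
    (hS : ∀ x ∈ S, x ∈ IntermediateField.adjoin K (insert t S'))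
    {e : E} (he : e ∈ IntermediateField.adjoin K S) (hse : ∀ i, s i e = e) :
    e ∈ IntermediateField.adjoin K S' := by
  refine mem_of_fixed_of_root s _ (fun i x hx => map_eq_self_of_mem_adjoin (s i) (hs i) hx) t hst
    p hp hdeg hroot e ?_ hse
  have h1 : IntermediateField.adjoin K S ≤ IntermediateField.adjoin K (insert t S') :=
    IntermediateField.adjoin_le_iff.2 hS
  have h2 : IntermediateField.adjoin K (insert t S') ≤
      (IntermediateField.adjoin (IntermediateField.adjoin K S') {t}).restrictScalars K := by
    refine IntermediateField.adjoin_le_iff.2 (Set.insert_subset ?_ fun x hx => ?_)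
    · exact IntermediateField.mem_adjoin_simple_self _ t
    · exact IntermediateField.algebraMap_mem _
        (⟨x, IntermediateField.subset_adjoin K S' hx⟩ : IntermediateField.adjoin K S')
  exact h2 (h1 he)

/-- A quadratic step: `K(S) ⊆ K(S')(w)` with `w² ∈ K(S')`, and `σ` fixes `S'` and negates `w`. -/
theorem mem_adjoin_of_fixed_of_sq {K E : Type*} [Field K] [Field E] [Algebra K E]
    (h2 : (2 : E) ≠ 0) (σ : E ≃ₐ[K] E) {S S' : Set E} {w : E} (hσ : ∀ x ∈ S', σ x = x)
    (hw : w ^ 2 ∈ IntermediateField.adjoin K S') (hw0 : w ≠ 0) (hσw : σ w = -w)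
    (hS : ∀ x ∈ S, x ∈ IntermediateField.adjoin K (insert w S'))
    {e : E} (he : e ∈ IntermediateField.adjoin K S) (hse : σ e = e) :
    e ∈ IntermediateField.adjoin K S' := by
  have hne : w ≠ -w := fun h => hw0 (by
    have : 2 * w = 0 := by linear_combination h
    simpa [h2] using this)
  refine mem_adjoin_of_fixed_of_root (fun i : Fin 2 => σ ^ (i : ℕ)) (t := w) ?_ ?_
    (Polynomial.X ^ 2 - Polynomial.C ⟨w ^ 2, hw⟩) ?_ ?_ ?_ hS he ?_
  · intro i x hx
    fin_cases i <;> simp [hσ x hx]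
  · intro i j hij
    fin_cases i <;> fin_cases j <;> simp_all
  · exact Polynomial.X_pow_sub_C_ne_zero two_pos _
  · simp
  · simp
  · intro i
    fin_cases i <;> simp [hse]

section SignedPerm
variable {K E Γ : Type*} [Field K] [Field E] [Algebra K E] [Group Γ]

open IntermediateField

/-- Let `Γ` act on `u` and `v` by signed permutations, not all of them diagonal. Then two elements
generate the fixed field of `K(u, v)`. The action factors through a subgroup of the dihedral group
of order eight, and the cases are told apart by which of `diag(-1, 1)`, the rotation `u ↦ v ↦ -u`
and `-1` occur: the whole group, the cyclic group of order four, the Klein group generated by `-1`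
and the exchange, or a single exchange `u ↦ ±v`. The fixed field is reached by quadratic steps. -/
theorem exists_generators_signed_perm (h2 : (2 : E) ≠ 0) (ρ : Γ →* (E ≃ₐ[K] E)) (u v : E)
    (hu : u ≠ 0) (hv : v ≠ 0) (huv : u ^ 2 ≠ v ^ 2) (huv' : u ^ 2 + v ^ 2 ≠ 0)
    (hρ : ∀ g, ((ρ g u = u ∨ ρ g u = -u) ∧ (ρ g v = v ∨ ρ g v = -v)) ∨
      ((ρ g u = v ∨ ρ g u = -v) ∧ (ρ g v = u ∨ ρ g v = -u)))
    (hτ : ∃ τ, (ρ τ u = v ∨ ρ τ u = -v) ∧ (ρ τ v = u ∨ ρ τ v = -u)) :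
    ∃ P : Finset E, P.card ≤ 2 ∧ (∀ x ∈ P, ∀ g, ρ g x = x) ∧
      ∀ x ∈ adjoin K {u, v}, (∀ g, ρ g x = x) → x ∈ adjoin K (P : Set E) := by
  classical
  obtain ⟨τ, hτu, hτv⟩ := hτ
  have hsub : u ^ 2 - v ^ 2 ≠ 0 := sub_ne_zero.2 huv
  have two_mem : ∀ L : IntermediateField K E, (2 : E) ∈ L := fun L => ofNat_mem L 2
  have hp : ∀ g, ρ g (u ^ 2 + v ^ 2) = u ^ 2 + v ^ 2 := by
    intro g
    rcases hρ g with ⟨h | h, h' | h'⟩ | ⟨h | h, h' | h'⟩ <;> simp [h, h', add_comm]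
  have mem : ∀ {a : E} {S : Set E}, a ∈ S → a ∈ adjoin K S := fun h => subset_adjoin K _ h
  -- Conjugation by `τ` interchanges the two sign changes.
  have hinv : ∀ y z, ρ τ y = z ∨ ρ τ y = -z → ∃ ε : E, ρ τ⁻¹ z = ε * y ∧ (ε = 1 ∨ ε = -1) ∧
      ρ τ y = ε * z := by
    have h1 : ∀ y, ρ τ⁻¹ (ρ τ y) = y := fun y => by
      rw [← AlgEquiv.mul_apply, ← map_mul, inv_mul_cancel, map_one, AlgEquiv.one_apply]
    rintro y z (h | h)
    · exact ⟨1, by rw [← h, h1, one_mul], by simp, by simp [h]⟩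
    · refine ⟨-1, ?_, by simp, by simp [h]⟩
      rw [← neg_neg z, ← h, map_neg, h1, neg_one_mul]
  have conj : ∀ g, ∀ a b : E, (a = 1 ∨ a = -1) → (b = 1 ∨ b = -1) → ρ g u = a * u → ρ g v = b * v →
      ρ (τ * g * τ⁻¹) u = b * u ∧ ρ (τ * g * τ⁻¹) v = a * v := by
    intro g a b ha hb hgu hgv
    obtain ⟨ε, h1, hε, h2⟩ := hinv u v hτu
    obtain ⟨δ, h3, hδ, h4⟩ := hinv v u hτv
    simp only [map_mul, AlgEquiv.mul_apply, h1, h3, hgu, hgv]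
    rcases ha with rfl | rfl <;> rcases hb with rfl | rfl <;> rcases hε with rfl | rfl <;>
      rcases hδ with rfl | rfl <;> simp [h2, h4]
  by_cases c1 : ∃ g, ρ g u = -u ∧ ρ g v = v
  · obtain ⟨g, hgu, hgv⟩ := c1
    obtain ⟨hgu', hgv'⟩ := conj g (-1) 1 (by simp) (by simp) (by simp [hgu]) (by simp [hgv])
    rw [one_mul] at hgu'
    rw [neg_one_mul] at hgv'
    refine ⟨{u ^ 2 + v ^ 2, u ^ 2 * v ^ 2}, Finset.card_le_two, ?_, fun x hx hfix => ?_⟩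
    · simp only [Finset.mem_insert, Finset.mem_singleton]
      rintro _ (rfl | rfl) g
      · exact hp g
      · rcases hρ g with ⟨h | h, h' | h'⟩ | ⟨h | h, h' | h'⟩ <;> simp [h, h', mul_comm]
    have hx1 : x ∈ adjoin K {u ^ 2, v} := by
      refine mem_adjoin_of_fixed_of_sq h2 (ρ g) (w := u) ?_ (mem (by simp)) hu hgu ?_ hx (hfix g)
      · rintro _ (rfl | rfl) <;> simp [hgu, hgv]
      · rintro _ (rfl | rfl) <;> exact mem (by simp)
    have hx2 : x ∈ adjoin K {u ^ 2, v ^ 2} := by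
      refine mem_adjoin_of_fixed_of_sq h2 (ρ (τ * g * τ⁻¹)) (w := v) ?_ (mem (by simp)) hv hgv' ?_
        hx1 (hfix _)
      · rintro _ (rfl | rfl) <;> simp only [map_pow, hgu', hgv', neg_sq]
      · rintro _ (rfl | rfl) <;> exact mem (by simp)
    rw [Finset.coe_insert, Finset.coe_singleton]
    refine mem_adjoin_of_fixed_of_sq h2 (ρ τ) (w := u ^ 2 - v ^ 2) ?_ ?_ hsub ?_ ?_ hx2 (hfix τ)
    · rintro _ (rfl | rfl)
      · exact hp τ
      · rcases hτu with h | h <;> rcases hτv with h' | h' <;> simp [h, h', mul_comm]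
    · have h3 : (u ^ 2 - v ^ 2) ^ 2 = (u ^ 2 + v ^ 2) ^ 2 - 2 * 2 * (u ^ 2 * v ^ 2) := by ring
      rw [h3]
      exact sub_mem (pow_mem (mem (by simp)) 2)
        (mul_mem (mul_mem (two_mem _) (two_mem _)) (mem (by simp)))
    · rcases hτu with h | h <;> rcases hτv with h' | h' <;> simp [h, h']
    · set L := adjoin K (insert (u ^ 2 - v ^ 2) {u ^ 2 + v ^ 2, u ^ 2 * v ^ 2})
      have hw : u ^ 2 - v ^ 2 ∈ L := mem (by simp)
      have hp : u ^ 2 + v ^ 2 ∈ L := mem (by simp)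
      rintro _ (rfl | rfl)
      · have h3 : u ^ 2 = ((u ^ 2 + v ^ 2) + (u ^ 2 - v ^ 2)) / 2 := by field_simp; ring
        rw [h3]
        exact div_mem (add_mem hp hw) (two_mem L)
      · have h3 : v ^ 2 = ((u ^ 2 + v ^ 2) - (u ^ 2 - v ^ 2)) / 2 := by field_simp; ring
        rw [h3]
        exact div_mem (sub_mem hp hw) (two_mem L)
  have c1' : ¬ ∃ g, ρ g u = u ∧ ρ g v = -v := by
    rintro ⟨g, hgu, hgv⟩
    obtain ⟨hgu', hgv'⟩ := conj g 1 (-1) (by simp) (by simp) (by simp [hgu]) (by simp [hgv])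
    exact c1 ⟨_, by rw [hgu', neg_one_mul], by rw [hgv', one_mul]⟩
  -- The field of `-1`-invariants is `K(u / v, v ^ 2)`.
  have even : ∀ g, ρ g u = -u → ρ g v = -v → ∀ x ∈ adjoin K {u, v}, ρ g x = x →
      x ∈ adjoin K {u / v, v ^ 2} := by
    intro g hgu hgv x hx hgx
    refine mem_adjoin_of_fixed_of_sq h2 (ρ g) (w := v) ?_ (mem (by simp)) hv hgv ?_ hx hgx
    · rintro _ (rfl | rfl) <;> simp [hgu, hgv]
    · rintro y (hy | hy) <;> rw [hy]
      · rw [← div_mul_cancel₀ u hv]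
        exact mul_mem (mem (by simp [hv])) (mem (by simp))
      · exact mem (by simp)
  by_cases c2 : ∃ g, ρ g u = v ∧ ρ g v = -u
  · obtain ⟨g, hgu, hgv⟩ := c2
    refine ⟨{u ^ 2 + v ^ 2, (u ^ 2 - v ^ 2) / (u * v)}, Finset.card_le_two, ?_, fun x hx hfix => ?_⟩
    · simp only [Finset.mem_insert, Finset.mem_singleton]
      rintro _ (rfl | rfl) k
      · exact hp k
      · rcases hρ k with ⟨h | h, h' | h'⟩ | ⟨h | h, h' | h'⟩
        · simp [h, h']
        · exact absurd ⟨k, h, h'⟩ c1'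
        · exact absurd ⟨k, h, h'⟩ c1
        · simp [h, h']
        · exact absurd ⟨k * g, by simp [hgu, h'], by simp [hgv, h]⟩ c1'
        · simp [h, h']; field_simp; ring
        · simp [h, h']; field_simp; ring
        · exact absurd ⟨k * g, by simp [hgu, h'], by simp [hgv, h]⟩ c1
    have hx1 := even (g * g) (by simp [hgu, hgv]) (by simp [hgu, hgv]) x hx (hfix _)
    rw [Finset.coe_insert, Finset.coe_singleton]
    -- With `s = u / v`, the rotation maps `s` to `-1 / s`, so it fixes `s - 1 / s` and negates
    -- `s + 1 / s`.
    have hw : u / v + v / u = (u ^ 2 + v ^ 2) / (u * v) := by field_simp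
    refine mem_adjoin_of_fixed_of_sq h2 (ρ g) (w := u / v + v / u) ?_ ?_ ?_ ?_ ?_ hx1 (hfix g)
    · rintro _ (rfl | rfl)
      · exact hp g
      · simp [hgu, hgv]; field_simp; ring
    · have h3 : (u / v + v / u) ^ 2 = ((u ^ 2 - v ^ 2) / (u * v)) ^ 2 + 2 * 2 := by
        field_simp; ring
      rw [h3]
      exact add_mem (pow_mem (mem (by simp)) 2) (mul_mem (two_mem _) (two_mem _))
    · rw [hw]
      exact div_ne_zero huv' (mul_ne_zero hu hv)
    · simp [hgu, hgv]; field_simp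
    · set L := adjoin K (insert (u / v + v / u) {u ^ 2 + v ^ 2, (u ^ 2 - v ^ 2) / (u * v)})
      have hw : u / v + v / u ∈ L := mem (by simp)
      have hp : u ^ 2 + v ^ 2 ∈ L := mem (by simp)
      have hq : (u ^ 2 - v ^ 2) / (u * v) ∈ L := mem (by simp)
      have hs : u / v ∈ L := by
        have h3 : u / v = ((u ^ 2 - v ^ 2) / (u * v) + (u / v + v / u)) / 2 := by
          field_simp; ring
        rw [h3]
        exact div_mem (add_mem hq hw) (two_mem L)
      rintro _ (rfl | rfl)
      · exact hs
      · have h3 : v ^ 2 = (u ^ 2 + v ^ 2) / ((u / v) ^ 2 + 1) := by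
          field_simp
        rw [h3]
        exact div_mem hp (add_mem (pow_mem hs 2) (one_mem L))
  -- Now every element exchanging the lines of `u` and `v` maps `(u, v)` to `(v, u)` or `(-v, -u)`.
  have c2' : ¬ ∃ g, ρ g u = -v ∧ ρ g v = u := by
    rintro ⟨g, hgu, hgv⟩
    exact c2 ⟨g * g * g, by simp [hgu, hgv], by simp [hgu, hgv]⟩
  by_cases c3 : ∃ g, ρ g u = -u ∧ ρ g v = -v
  · obtain ⟨g, hgu, hgv⟩ := c3
    refine ⟨{u ^ 2 + v ^ 2, u * v}, Finset.card_le_two, ?_, fun x hx hfix => ?_⟩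
    · simp only [Finset.mem_insert, Finset.mem_singleton]
      rintro _ (rfl | rfl) k
      · exact hp k
      · rcases hρ k with ⟨h | h, h' | h'⟩ | ⟨h | h, h' | h'⟩
        · simp [h, h']
        · exact absurd ⟨k, h, h'⟩ c1'
        · exact absurd ⟨k, h, h'⟩ c1
        · simp [h, h']
        · simp [h, h', mul_comm]
        · exact absurd ⟨k, h, h'⟩ c2
        · exact absurd ⟨k, h, h'⟩ c2'
        · simp [h, h', mul_comm]
    have hx1 := even g hgu hgv x hx (hfix _)
    rw [Finset.coe_insert, Finset.coe_singleton]
    -- With `s = u / v`, the exchange maps `s` to `1 / s`, so it negates `s - 1 / s`.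
    have hτ : ρ τ u * ρ τ v = u * v ∧ ρ τ u / ρ τ v = v / u := by
      rcases hτu with h | h <;> rcases hτv with h' | h'
      · simp [h, h', mul_comm]
      · exact absurd ⟨τ, h, h'⟩ c2
      · exact absurd ⟨τ, h, h'⟩ c2'
      · simp [h, h', mul_comm]
    have hτ' : ρ τ v / ρ τ u = u / v := by rw [← inv_div, hτ.2, inv_div]
    refine mem_adjoin_of_fixed_of_sq h2 (ρ τ) (w := u / v - v / u) ?_ ?_ ?_ ?_ ?_ hx1 (hfix τ)
    · rintro _ (rfl | rfl)
      · exact hp τ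
      · simp [hτ.1]
    · have h3 : (u / v - v / u) ^ 2 = ((u ^ 2 + v ^ 2) / (u * v)) ^ 2 - 2 * 2 := by
        field_simp; ring
      rw [h3]
      exact sub_mem (pow_mem (div_mem (mem (by simp)) (mem (by simp))) 2)
        (mul_mem (two_mem _) (two_mem _))
    · have h3 : u / v - v / u = (u ^ 2 - v ^ 2) / (u * v) := by field_simp
      rw [h3]
      exact div_ne_zero hsub (mul_ne_zero hu hv)
    · simp [hτ.2, hτ']
    · set L := adjoin K (insert (u / v - v / u) {u ^ 2 + v ^ 2, u * v})
      have hw : u / v - v / u ∈ L := mem (by simp)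
      have hp : u ^ 2 + v ^ 2 ∈ L := mem (by simp)
      have hq : u * v ∈ L := mem (by simp)
      have hs : u / v ∈ L := by
        have h3 : u / v = ((u ^ 2 + v ^ 2) / (u * v) + (u / v - v / u)) / 2 := by
          field_simp; ring
        rw [h3]
        exact div_mem (add_mem (div_mem hp hq) hw) (two_mem L)
      rintro _ (rfl | rfl)
      · exact hs
      · have h3 : v ^ 2 = u * v / (u / v) := by field_simp
        rw [h3]
        exact div_mem hq hs
  obtain ⟨ε, hε, hτu, hτv⟩ : ∃ ε : E, (ε = 1 ∨ ε = -1) ∧ ρ τ u = ε * v ∧ ρ τ v = ε * u := by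
    rcases hτu with h | h <;> rcases hτv with h' | h'
    · exact ⟨1, by simp, by simp [h], by simp [h']⟩
    · exact absurd ⟨τ, h, h'⟩ c2
    · exact absurd ⟨τ, h, h'⟩ c2'
    · exact ⟨-1, by simp, by simp [h], by simp [h']⟩
  have hεfix : ∀ g, ρ g ε = ε := fun g => by rcases hε with rfl | rfl <;> simp
  have hε2 : ε * ε = 1 := by rcases hε with rfl | rfl <;> simp
  have hεmem : ∀ L : IntermediateField K E, ε ∈ L := fun L => by
    rcases hε with rfl | rfl
    · exact one_mem L
    · exact neg_mem (one_mem L)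
  refine ⟨{u + ε * v, u * v}, Finset.card_le_two, ?_, fun x hx hfix => ?_⟩
  · have hk : ∀ k, (ρ k u = u ∧ ρ k v = v) ∨ (ρ k u = ε * v ∧ ρ k v = ε * u) := by
      intro k
      rcases hρ k with ⟨h | h, h' | h'⟩ | ⟨h | h, h' | h'⟩
      · exact Or.inl ⟨h, h'⟩
      · exact absurd ⟨k, h, h'⟩ c1'
      · exact absurd ⟨k, h, h'⟩ c1
      · exact absurd ⟨k, h, h'⟩ c3
      · rcases hε with rfl | rfl
        · simp [h, h']
        · exact absurd ⟨k * τ, by simp [hτu, h'], by simp [hτv, h]⟩ c3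
      · exact absurd ⟨k, h, h'⟩ c2
      · exact absurd ⟨k, h, h'⟩ c2'
      · rcases hε with rfl | rfl
        · exact absurd ⟨k * τ, by simp [hτu, h'], by simp [hτv, h]⟩ c3
        · simp [h, h']
    simp only [Finset.mem_insert, Finset.mem_singleton]
    rintro _ (rfl | rfl) k
    · rcases hk k with ⟨h, h'⟩ | ⟨h, h'⟩
      · simp [h, h', hεfix]
      · simp only [map_add, map_mul, h, h', hεfix]
        linear_combination u * hε2
    · rcases hk k with ⟨h, h'⟩ | ⟨h, h'⟩
      · simp [h, h']
      · simp only [map_mul, h, h']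
        linear_combination u * v * hε2
  rw [Finset.coe_insert, Finset.coe_singleton]
  refine mem_adjoin_of_fixed_of_sq h2 (ρ τ) (w := u - ε * v) ?_ ?_ ?_ ?_ ?_ hx (hfix τ)
  · rintro _ (rfl | rfl)
    · simp only [map_add, map_mul, hτu, hτv, hεfix]
      linear_combination u * hε2
    · simp only [map_mul, hτu, hτv]
      linear_combination u * v * hε2
  · have h3 : (u - ε * v) ^ 2 = (u + ε * v) ^ 2 - 2 * 2 * ε * (u * v) := by ring
    rw [h3]
    exact sub_mem (pow_mem (mem (by simp)) 2)
      (mul_mem (mul_mem (mul_mem (two_mem _) (two_mem _)) (hεmem _)) (mem (by simp)))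
  · intro h
    apply huv
    linear_combination (u + ε * v) * h + v ^ 2 * hε2
  · simp only [map_sub, map_mul, hτu, hτv, hεfix]
    linear_combination -u * hε2
  · set L := adjoin K (insert (u - ε * v) {u + ε * v, u * v})
    have hw : u - ε * v ∈ L := mem (by simp)
    have hp : u + ε * v ∈ L := mem (by simp)
    have hu' : u ∈ L := by
      have h3 : u = ((u + ε * v) + (u - ε * v)) / 2 := by field_simp; ring
      rw [h3]
      exact div_mem (add_mem hp hw) (two_mem L)
    rintro y (hy | hy) <;> rw [hy]
    · exact hu'
    · have h3 : v = (u * v) / u := by field_simp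
      rw [h3]
      exact div_mem (mem (by simp)) hu'
end SignedPerm

section Triple
variable {K E : Type*} [Field K] [Field E] [Algebra K E]

/-! ### Rational functions of three elements -/

/-- The coordinate of a triple that is invariant under affine transformations. -/
def diffRatio (z : Fin 3 → E) : E := (z 0 - z 1) / (z 1 - z 2)

/-- The product of the differences, which is multiplied by the sign under permutations. -/
def diffProd (z : Fin 3 → E) : E := (z 0 - z 1) * (z 1 - z 2) * (z 2 - z 0)

/-- The product of the second differences, which is symmetric. -/
def diffNum (z : Fin 3 → E) : E :=
  (z 0 - 2 * z 1 + z 2) * (z 1 - 2 * z 2 + z 0) * (z 2 - 2 * z 0 + z 1)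

/-- A rational function of degree three in `diffRatio`, see `signInv_eq`, which is multiplied by the
sign under permutations and so is invariant under rotations. -/
def signInv (z : Fin 3 → E) : E := diffNum z / diffProd z

theorem map_diffRatio (f : E ≃ₐ[K] E) (z : Fin 3 → E) : f (diffRatio z) = diffRatio (f ∘ z) := by
  simp [diffRatio]

theorem map_signInv (f : E ≃ₐ[K] E) (z : Fin 3 → E) : f (signInv z) = signInv (f ∘ z) := by
  simp [signInv, diffNum, diffProd, map_ofNat f 2]

theorem perm_fin_three (π : Equiv.Perm (Fin 3)) :
    (π 0 = 0 ∧ π 1 = 1 ∧ π 2 = 2) ∨ (π 0 = 1 ∧ π 1 = 2 ∧ π 2 = 0) ∨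
    (π 0 = 2 ∧ π 1 = 0 ∧ π 2 = 1) ∨ (π 0 = 1 ∧ π 1 = 0 ∧ π 2 = 2) ∨
    (π 0 = 0 ∧ π 1 = 2 ∧ π 2 = 1) ∨ (π 0 = 2 ∧ π 1 = 1 ∧ π 2 = 0) := by
  revert π
  decide

theorem signInv_comp_perm (z : Fin 3 → E) (π : Equiv.Perm (Fin 3)) :
    signInv (z ∘ π) = signInv z ∨ signInv (z ∘ π) = -signInv z := by
  have hN : diffNum (z ∘ π) = diffNum z := by
    rcases perm_fin_three π with ⟨h0, h1, h2⟩ | ⟨h0, h1, h2⟩ | ⟨h0, h1, h2⟩ | ⟨h0, h1, h2⟩ |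
      ⟨h0, h1, h2⟩ | ⟨h0, h1, h2⟩ <;> simp only [diffNum, Function.comp, h0, h1, h2] <;> ring
  have hD : diffProd (z ∘ π) = diffProd z ∨ diffProd (z ∘ π) = -diffProd z := by
    rcases perm_fin_three π with ⟨h0, h1, h2⟩ | ⟨h0, h1, h2⟩ | ⟨h0, h1, h2⟩ | ⟨h0, h1, h2⟩ |
      ⟨h0, h1, h2⟩ | ⟨h0, h1, h2⟩ <;> simp only [diffProd, Function.comp, h0, h1, h2]
    · exact Or.inl trivial
    · left; ring
    · left; ring
    · right; ring
    · right; ring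
    · right; ring
  rcases hD with h | h
  · left; rw [signInv, hN, h, signInv]
  · right; rw [signInv, hN, h, signInv, div_neg]

theorem signInv_rotate (z : Fin 3 → E) : signInv (fun i => z (i + 1)) = signInv z := by
  simp only [signInv, diffNum, diffProd, Fin.reduceAdd]
  congr 1 <;> ring

variable {z : Fin 3 → E} (hz : Function.Injective z)
include hz

theorem diffRatio_ne_zero : diffRatio z ≠ 0 :=
  div_ne_zero (sub_ne_zero.2 (hz.ne (by decide))) (sub_ne_zero.2 (hz.ne (by decide)))

theorem diffRatio_add_one : diffRatio z + 1 = -(z 2 - z 0) / (z 1 - z 2) := by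
  have h12 : z 1 - z 2 ≠ 0 := sub_ne_zero.2 (hz.ne (by decide))
  rw [diffRatio]
  field_simp
  ring

theorem diffRatio_add_one_ne_zero : diffRatio z + 1 ≠ 0 := by
  rw [diffRatio_add_one hz]
  exact div_ne_zero (neg_ne_zero.2 (sub_ne_zero.2 (hz.ne (by decide))))
    (sub_ne_zero.2 (hz.ne (by decide)))

theorem signInv_eq : signInv z = (diffRatio z - 1) * (diffRatio z + 2) * (2 * diffRatio z + 1) /
    (diffRatio z * (diffRatio z + 1)) := by
  have h01 : z 0 - z 1 ≠ 0 := sub_ne_zero.2 (hz.ne (by decide))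
  have h12 : z 1 - z 2 ≠ 0 := sub_ne_zero.2 (hz.ne (by decide))
  have h20 : z 2 - z 0 ≠ 0 := sub_ne_zero.2 (hz.ne (by decide))
  rw [signInv, diffNum, diffProd, diffRatio_add_one hz, diffRatio]
  field_simp
  ring

theorem diffRatio_comp_perm_mem (π : Equiv.Perm (Fin 3)) :
    diffRatio (z ∘ π) ∈ IntermediateField.adjoin K {diffRatio z} := by
  have h12 : z 1 - z 2 ≠ 0 := sub_ne_zero.2 (hz.ne (by decide))
  set L := IntermediateField.adjoin K {diffRatio z}
  have ht : diffRatio z ∈ L := IntermediateField.mem_adjoin_simple_self K _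
  have h1 : (z 0 - z 1) / (z 1 - z 2) ∈ L := ht
  have h2 : (z 1 - z 2) / (z 1 - z 2) ∈ L := by rw [div_self h12]; exact one_mem L
  have key : ∀ i, (z i - z 1) / (z 1 - z 2) ∈ L := by
    intro i
    fin_cases i
    · exact h1
    · simp
    · convert neg_mem h2 using 1
      simp [← neg_div]
  have key2 : ∀ i j, (z i - z j) / (z 1 - z 2) ∈ L := by
    intro i j
    convert sub_mem (key i) (key j) using 1
    rw [← sub_div]
    ring
  have h3 := div_mem (key2 (π 0) (π 1)) (key2 (π 1) (π 2))
  rwa [div_div_div_cancel_right₀ h12] at h3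

end Triple

open IntermediateField

/-- A cubic step: `t = diffRatio z` is a root of `(X - 1)(X + 2)(2X + 1) - u X(X + 1)` with
`u = signInv z`, and a rotation of `z` fixes `u` and moves `t`. The leading coefficient is `2`. -/
theorem mem_adjoin_of_fixed_of_rotation {K E : Type*} [Field K] [Field E] [Algebra K E]
    (h2 : (2 : E) ≠ 0) {z : Fin 3 → E} (hz : Function.Injective z) (σ : E ≃ₐ[K] E)
    (hσ : ∀ i, σ (z i) = z (i + 1)) (hne : σ (diffRatio z) ≠ diffRatio z) {S S' : Set E}
    (hσS : ∀ x ∈ S', σ x = x) (hmem : signInv z ∈ adjoin K S')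
    (hS : ∀ x ∈ S, x ∈ adjoin K (insert (diffRatio z) S'))
    {e : E} (he : e ∈ adjoin K S) (hσe : σ e = e) : e ∈ adjoin K S' := by
  set L := adjoin K S'
  set t := diffRatio z with ht
  set u : L := ⟨signInv z, hmem⟩
  have h2L : (2 : L) ≠ 0 := fun h => h2 (by
    rw [← map_ofNat (algebraMap L E) 2, h, map_zero])
  set p : Polynomial L := .C 2 * .X ^ 3 + .C (3 - u) * .X ^ 2 + .C (-3 - u) * .X + .C (-2)
  have hdeg : p.natDegree = 3 := Polynomial.natDegree_cubic h2L
  have hσ3 : σ (σ (σ t)) = t := by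
    simp only [ht, diffRatio, map_div₀, map_sub, hσ, Fin.reduceAdd]
  have hne2 : σ (σ t) ≠ t := fun h => hne (by rw [h] at hσ3; exact hσ3)
  refine mem_adjoin_of_fixed_of_root (fun i : Fin 3 => σ ^ (i : ℕ)) (t := t) ?_ ?_ p
    (fun h => by simp [h] at hdeg) (by simp [hdeg]) ?_ hS he ?_
  · intro i x hx
    fin_cases i <;> simp [hσS x hx, pow_two]
  · intro i j hij
    have hne3 : σ (σ t) ≠ σ t := fun h => hne (σ.injective h)
    fin_cases i <;> fin_cases j <;> simp [pow_two, hne, hne2, hne3, hne.symm, hne2.symm, hne3.symm]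
      at hij ⊢
  · have h1 : Polynomial.aeval t p = 2 * t ^ 3 + (3 - signInv z) * t ^ 2 + (-3 - signInv z) * t - 2 := by
      simp [p, u, sub_eq_add_neg]
      rw [show ((2 : L) : E) = 2 from map_ofNat (algebraMap L E) 2,
        show ((3 : L) : E) = 3 from map_ofNat (algebraMap L E) 3]
    have ht0 := diffRatio_ne_zero hz
    have ht1 := diffRatio_add_one_ne_zero hz
    rw [h1, signInv_eq hz]
    field_simp
    ring
  · intro i
    fin_cases i <;> simp [hσe, pow_two]

theorem AlgebraicIndependent.aeval_ne_zero_of_eval {K E ι : Type*} [Field K] [Field E] [Algebra K E]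
    {y : ι → E} (hy : AlgebraicIndependent K y) {p : MvPolynomial ι K} (a : ι → K)
    (ha : MvPolynomial.eval a p ≠ 0) : MvPolynomial.aeval y p ≠ 0 :=
  fun h => ha (by rw [(map_eq_zero_iff _ hy).1 h, map_zero])

/-- For algebraically independent entries, `diffRatio` distinguishes all orderings. -/
theorem eq_one_of_diffRatio_comp_perm {K E : Type*} [Field K] [Field E] [Algebra K E]
    {z : Fin 3 → E} (hz : AlgebraicIndependent K z) (π : Equiv.Perm (Fin 3))
    (h : diffRatio (z ∘ π) = diffRatio z) : π = 1 := by
  have hinj := hz.injective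
  simp only [diffRatio, Function.comp] at h
  rw [div_eq_div_iff (sub_ne_zero.2 (hinj.ne (π.injective.ne (by decide))))
    (sub_ne_zero.2 (hinj.ne (by decide)))] at h
  have key : ∀ a : Fin 3 → K, (a (π 0) - a (π 1)) * (a 1 - a 2) =
      (a 0 - a 1) * (a (π 1) - a (π 2)) := by
    intro a
    by_contra hne
    refine hz.aeval_ne_zero_of_eval (p := (.X (π 0) - .X (π 1)) * (.X 1 - .X 2) -
      (.X 0 - .X 1) * (.X (π 1) - .X (π 2))) a ?_ ?_
    · simpa [sub_eq_zero] using hne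
    · simpa [sub_eq_zero] using h
  -- These two points suffice to exclude every nontrivial permutation.
  have h1 := key (Pi.single 2 1)
  have h2 := key (Pi.single 0 1)
  rcases perm_fin_three π with ⟨e0, e1, e2⟩ | ⟨e0, e1, e2⟩ | ⟨e0, e1, e2⟩ | ⟨e0, e1, e2⟩ |
      ⟨e0, e1, e2⟩ | ⟨e0, e1, e2⟩ 
  · ext i
    fin_cases i <;> simp [e0, e1, e2]
  all_goals simp [e0, e1, e2] at h1 h2

section Blocks
variable {K E : Type*} [Field K] [Field E] [Algebra K E]
  {z w : Fin 3 → E} (h : AlgebraicIndependent K (Sum.elim z w))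
include h

theorem diffRatio_comp_perm_ne (π : Equiv.Perm (Fin 3)) : diffRatio (w ∘ π) ≠ diffRatio z := by
  have hinj := h.injective
  have hz : Function.Injective z := hinj.comp Sum.inl_injective
  have hw : Function.Injective w := hinj.comp Sum.inr_injective
  simp only [diffRatio, Function.comp]
  rw [Ne, div_eq_div_iff
    (sub_ne_zero.2 (hw.ne (π.injective.ne (by decide)))) (sub_ne_zero.2 (hz.ne (by decide)))]
  have := h.aeval_ne_zero_of_eval (p := (.X (.inr (π 0)) - .X (.inr (π 1))) *
    (.X (.inl 1) - .X (.inl 2)) - (.X (.inl 0) - .X (.inl 1)) *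
    (.X (.inr (π 1)) - .X (.inr (π 2)))) (Sum.elim ![0, 1, 0] (Pi.single (π 0) 1)) (by
      simp)
  simpa [sub_eq_zero] using this

theorem signInv_ne_zero (h2 : (2 : K) ≠ 0) : signInv z ≠ 0 := by
  have hz : Function.Injective z := h.injective.comp Sum.inl_injective
  refine div_ne_zero ?_ (by simp [diffProd, sub_eq_zero, hz.eq_iff])
  have := h.aeval_ne_zero_of_eval (p := (.X (.inl 0) - 2 * .X (.inl 1) + .X (.inl 2)) *
    (.X (.inl 1) - 2 * .X (.inl 2) + .X (.inl 0)) *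
    (.X (.inl 2) - 2 * .X (.inl 0) + .X (.inl 1))) (Sum.elim ![0, 0, 1] 0) (by simp [h2])
  simpa [diffNum, map_ofNat] using this

theorem signInv_sq_add_mul_ne_zero (h2 : (2 : K) ≠ 0) (ε : K) (hε : ε ≠ 0) :
    signInv z ^ 2 + algebraMap K E ε * signInv w ^ 2 ≠ 0 := by
  have hz : Function.Injective z := h.injective.comp Sum.inl_injective
  have hw : Function.Injective w := h.injective.comp Sum.inr_injective
  have hz0 : diffProd z ≠ 0 := by simp [diffProd, sub_eq_zero, hz.eq_iff]
  have hw0 : diffProd w ≠ 0 := by simp [diffProd, sub_eq_zero, hw.eq_iff]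
  set N : (Fin 3 → Fin 3 ⊕ Fin 3) → MvPolynomial (Fin 3 ⊕ Fin 3) K := fun c =>
    (.X (c 0) - 2 * .X (c 1) + .X (c 2)) * (.X (c 1) - 2 * .X (c 2) + .X (c 0)) *
    (.X (c 2) - 2 * .X (c 0) + .X (c 1))
  set D : (Fin 3 → Fin 3 ⊕ Fin 3) → MvPolynomial (Fin 3 ⊕ Fin 3) K := fun c =>
    (.X (c 0) - .X (c 1)) * (.X (c 1) - .X (c 2)) * (.X (c 2) - .X (c 0))
  have := h.aeval_ne_zero_of_eval (p := N .inl ^ 2 * D .inr ^ 2 +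
    .C ε * (N .inr ^ 2 * D .inl ^ 2)) (Sum.elim ![0, 1, -1] ![0, 0, 1]) (by
      have h3 : (1 : K) + 1 ≠ 0 := by rwa [one_add_one_eq_two]
      simp [N, D, h2, hε, h3])
  have h4 : diffNum z ^ 2 * diffProd w ^ 2 + algebraMap K E ε * (diffNum w ^ 2 * diffProd z ^ 2) ≠ 0 := by
    simpa [N, D, diffNum, diffProd, map_ofNat] using this
  rw [signInv, signInv]
  have h5 : (diffNum z / diffProd z) ^ 2 + algebraMap K E ε * (diffNum w / diffProd w) ^ 2 =
    (diffNum z ^ 2 * diffProd w ^ 2 + algebraMap K E ε * (diffNum w ^ 2 * diffProd z ^ 2)) /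
      (diffProd z ^ 2 * diffProd w ^ 2) := by
    field_simp
  rw [h5]
  exact div_ne_zero h4 (mul_ne_zero (pow_ne_zero 2 hz0) (pow_ne_zero 2 hw0))

end Blocks

/-! ### The fixed field for two blocks of size three -/

/-- The fixed field of the two rotations in `K(t, t')` is `K(u, v)`, by two cubic steps. -/
theorem mem_adjoin_signInv_of_fixed {K E : Type*} [Field K] [Field E] [Algebra K E]
    (h2 : (2 : E) ≠ 0) {z w : Fin 3 → E} (hzi : AlgebraicIndependent K z)
    (hwi : AlgebraicIndependent K w) (σ σ' : E ≃ₐ[K] E) (hσz : ∀ i, σ (z i) = z (i + 1))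
    (hσw : ∀ i, σ (w i) = w i) (hσz' : ∀ i, σ' (z i) = z i) (hσw' : ∀ i, σ' (w i) = w (i + 1))
    (x : E) (hx : x ∈ adjoin K {diffRatio z, diffRatio w}) (hσx : σ x = x) (hσx' : σ' x = x) :
    x ∈ adjoin K {signInv z, signInv w} := by
  have hz := hzi.injective
  have hw := hwi.injective
  have hfix1 : ∀ (f : E ≃ₐ[K] E) (y : Fin 3 → E), (∀ i, f (y i) = y i) →
      f (diffRatio y) = diffRatio y ∧ f (signInv y) = signInv y := by
    intro f y hf
    have : f ∘ y = y := funext hf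
    rw [map_diffRatio, map_signInv, this]
    simp
  have hrot : ∀ (f : E ≃ₐ[K] E) (y : Fin 3 → E), AlgebraicIndependent K y →
      (∀ i, f (y i) = y (i + 1)) →
      f (diffRatio y) ≠ diffRatio y ∧ f (signInv y) = signInv y := by
    intro f y hy hf
    have : f ∘ y = y ∘ Equiv.addRight 1 := funext hf
    rw [map_diffRatio, map_signInv, this]
    refine ⟨fun h3 => ?_, signInv_rotate y⟩
    have h4 := DFunLike.congr_fun (eq_one_of_diffRatio_comp_perm hy _ h3) 0
    simp at h4
  have mem : ∀ {a : E} {S : Set E}, a ∈ S → a ∈ adjoin K S := fun h => subset_adjoin K _ h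
  have hx1 : x ∈ adjoin K {signInv z, diffRatio w} := by
    refine mem_adjoin_of_fixed_of_rotation h2 hz σ hσz (hrot _ z hzi hσz).1
      (S := {diffRatio z, diffRatio w}) (S' := {signInv z, diffRatio w}) ?_ (mem (by simp)) ?_ hx hσx
    · rintro _ (rfl | rfl)
      · exact (hrot _ z hzi hσz).2
      · exact (hfix1 _ w hσw).1
    · rintro _ (rfl | rfl) <;> exact mem (by simp)
  refine mem_adjoin_of_fixed_of_rotation h2 hw σ' hσw' (hrot _ w hwi hσw').1
    (S := {signInv z, diffRatio w}) (S' := {signInv z, signInv w}) ?_ (mem (by simp)) ?_ hx1 hσx'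
  · rintro _ (rfl | rfl)
    · exact (hfix1 _ z hσz').2
    · exact (hrot _ w hwi hσw').2
  · rintro _ (rfl | rfl) <;> exact mem (by simp)

/-- The data required by `noetherProblemPositive_of_isPretransitive` for a group that permutes two
blocks of size three and contains their rotations and an exchange of them. -/
theorem exists_generators_of_blocks {K E Γ : Type*} [Field K] [Field E] [Algebra K E] [Group Γ]
    (h2 : (2 : K) ≠ 0) (ρ : Γ →* (E ≃ₐ[K] E)) {z w : Fin 3 → E}
    (h : AlgebraicIndependent K (Sum.elim z w))
    (hρ : ∀ g, ∃ π π' : Equiv.Perm (Fin 3),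
      (ρ g ∘ z = z ∘ π ∧ ρ g ∘ w = w ∘ π') ∨ (ρ g ∘ z = w ∘ π ∧ ρ g ∘ w = z ∘ π'))
    (hfaith : ∀ g, ρ g ∘ z = z → ρ g ∘ w = w → g = 1)
    (hc : ∃ c, (∀ i, ρ c (z i) = z (i + 1)) ∧ ∀ i, ρ c (w i) = w i)
    (hd : ∃ d, (∀ i, ρ d (z i) = z i) ∧ ∀ i, ρ d (w i) = w (i + 1))
    (hτ : ∃ τ, ∀ i, ρ τ (z i) = w i) :
    ∃ (F : IntermediateField K E) (P W : Finset E),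
      (∀ g, ∀ x ∈ F, ρ g x ∈ F) ∧ (∀ g, (∀ x ∈ F, ρ g x = x) → g = 1) ∧
      (∀ x ∈ P, ∀ g, ρ g x = x) ∧
      (∀ x ∈ F, (∀ g, ρ g x = x) → x ∈ adjoin K (P : Set E)) ∧
      (∀ i, z i ∈ Submodule.span F (insert 1 (W : Set E))) ∧
      (∀ i, w i ∈ Submodule.span F (insert 1 (W : Set E))) ∧
      P.card + W.card ≤ 6 := by
  classical
  have hz : Function.Injective z := h.injective.comp Sum.inl_injective
  have hw : Function.Injective w := h.injective.comp Sum.inr_injective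
  have hzi : AlgebraicIndependent K z := by
    have := h.comp Sum.inl Sum.inl_injective
    rwa [Sum.elim_comp_inl] at this
  have hwi : AlgebraicIndependent K w := by
    have := h.comp Sum.inr Sum.inr_injective
    rwa [Sum.elim_comp_inr] at this
  have hwz : AlgebraicIndependent K (Sum.elim w z) := by
    have := h.comp _ (Equiv.sumComm (Fin 3) (Fin 3)).injective
    convert this using 1
    ext (i | i) <;> rfl
  have h2E : (2 : E) ≠ 0 := by
    rw [← map_ofNat (algebraMap K E) 2]
    exact (map_ne_zero _).2 h2
  obtain ⟨c, hcz, hcw⟩ := hc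
  obtain ⟨d, hdz, hdw⟩ := hd
  obtain ⟨τ, hτz⟩ := hτ
  set F : IntermediateField K E := adjoin K {diffRatio z, diffRatio w} with hF
  have htz : diffRatio z ∈ F := subset_adjoin K _ (by simp)
  have htw : diffRatio w ∈ F := subset_adjoin K _ (by simp)
  have hmono : ∀ {a : E}, a ∈ F → adjoin K {a} ≤ F := fun ha => adjoin_simple_le_iff.2 ha
  have hstable : ∀ g, ∀ x ∈ F, ρ g x ∈ F := by
    intro g x hx
    obtain ⟨π, π', ⟨h1, h1'⟩ | ⟨h1, h1'⟩⟩ := hρ g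
    · refine map_mem_adjoin (s := {diffRatio z, diffRatio w}) (ρ g) ?_ hx
      rintro _ (rfl | rfl)
      · rw [map_diffRatio, h1]
        exact hmono htz (diffRatio_comp_perm_mem hz π)
      · rw [map_diffRatio, h1']
        exact hmono htw (diffRatio_comp_perm_mem hw π')
    · refine map_mem_adjoin (s := {diffRatio z, diffRatio w}) (ρ g) ?_ hx
      rintro _ (rfl | rfl)
      · rw [map_diffRatio, h1]
        exact hmono htw (diffRatio_comp_perm_mem hw π)
      · rw [map_diffRatio, h1']
        exact hmono htz (diffRatio_comp_perm_mem hz π')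
  have hFfaith : ∀ g, (∀ x ∈ F, ρ g x = x) → g = 1 := by
    intro g hg
    have e1 := hg _ htz
    have e2 := hg _ htw
    rw [map_diffRatio] at e1 e2
    obtain ⟨π, π', ⟨h1, h1'⟩ | ⟨h1, h1'⟩⟩ := hρ g
    · rw [h1] at e1
      rw [h1'] at e2
      obtain rfl := eq_one_of_diffRatio_comp_perm hzi π e1
      obtain rfl := eq_one_of_diffRatio_comp_perm hwi π' e2
      exact hfaith g h1 h1'
    · rw [h1] at e1
      exact absurd e1 (diffRatio_comp_perm_ne h π)
  have hsign : ∀ g, ((ρ g (signInv z) = signInv z ∨ ρ g (signInv z) = -signInv z) ∧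
        (ρ g (signInv w) = signInv w ∨ ρ g (signInv w) = -signInv w)) ∨
      ((ρ g (signInv z) = signInv w ∨ ρ g (signInv z) = -signInv w) ∧
        (ρ g (signInv w) = signInv z ∨ ρ g (signInv w) = -signInv z)) := by
    intro g
    rw [map_signInv, map_signInv]
    obtain ⟨π, π', ⟨h1, h1'⟩ | ⟨h1, h1'⟩⟩ := hρ g
    · rw [h1, h1']
      exact Or.inl ⟨signInv_comp_perm z π, signInv_comp_perm w π'⟩
    · rw [h1, h1']
      exact Or.inr ⟨signInv_comp_perm w π, signInv_comp_perm z π'⟩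
  have hsq : signInv z ^ 2 ≠ signInv w ^ 2 := by
    have := signInv_sq_add_mul_ne_zero h h2 (-1) (by simp)
    intro h3
    apply this
    simp [h3]
  have hu0 := signInv_ne_zero h h2
  have hv0 := signInv_ne_zero hwz h2
  have hswap : ∃ τ, (ρ τ (signInv z) = signInv w ∨ ρ τ (signInv z) = -signInv w) ∧
      (ρ τ (signInv w) = signInv z ∨ ρ τ (signInv w) = -signInv z) := by
    refine ⟨τ, (hsign τ).resolve_left fun hcon => ?_⟩
    have h3 : ρ τ (signInv z) = signInv w := by
      rw [map_signInv]
      congr 1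
      ext i
      exact hτz i
    rw [h3] at hcon
    rcases hcon.1 with h4 | h4
    · exact hsq (by rw [h4])
    · exact hsq (by rw [h4, neg_sq])
  obtain ⟨P, hPcard, hPfix, hP⟩ := exists_generators_signed_perm h2E ρ (signInv z) (signInv w)
    hu0 hv0 hsq (by simpa using signInv_sq_add_mul_ne_zero h h2 1 one_ne_zero) hsign hswap
  have hspan : ∀ y : Fin 3 → E, Function.Injective y → diffRatio y ∈ F → ∀ {W : Finset E},
      y 0 ∈ W → y 1 ∈ W → ∀ i, y i ∈ Submodule.span F (insert 1 (W : Set E)) := by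
    intro y hy hty W h0 h1
    set M := Submodule.span F (insert 1 (W : Set E))
    have h0 : y 0 ∈ M := Submodule.subset_span (Set.mem_insert_of_mem _ h0)
    have h1 : y 1 ∈ M := Submodule.subset_span (Set.mem_insert_of_mem _ h1)
    rw [Fin.forall_fin_succ, Fin.forall_fin_two]
    refine ⟨h0, h1, ?_⟩
    -- `y 2 = y 1 - (y 1 - y 2)` and `y 1 - y 2 = t⁻¹ (y 0 - y 1)`.
    convert M.sub_mem h1 (M.smul_mem (⟨diffRatio y, hty⟩ : F)⁻¹ (M.sub_mem h0 h1)) using 1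
    have h01 : y 0 - y 1 ≠ 0 := sub_ne_zero.2 (hy.ne (by decide))
    have h12 : y 1 - y 2 ≠ 0 := sub_ne_zero.2 (hy.ne (by decide))
    simp only [IntermediateField.smul_def, smul_eq_mul, IntermediateField.coe_inv, diffRatio]
    simp
    field_simp
    ring
  refine ⟨F, P, {z 0, z 1, w 0, w 1}, hstable, hFfaith, hPfix, fun x hx hfix => ?_, ?_, ?_, ?_⟩
  · refine hP x ?_ hfix
    exact mem_adjoin_signInv_of_fixed h2E hzi hwi (ρ c) (ρ d) hcz hcw hdz hdw x hx (hfix c) (hfix d)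
  · exact hspan z hz htz (by simp) (by simp)
  · exact hspan w hw htw (by simp) (by simp)
  · have h5 : ({z 0, z 1, w 0, w 1} : Finset E).card ≤ 4 := Finset.card_le_four
    omega

/-! ### Imprimitive groups of degree six with a 3-cycle -/

open scoped Pointwise

theorem ContainsC3C3.exists_isThreeCycle {G : Subgroup (Equiv.Perm (Fin 6))}
    (hG : ContainsC3C3 G) : ∃ c ∈ G, c.IsThreeCycle := by
  obtain ⟨H, hHG, ⟨e⟩⟩ := hG
  have hcard : Nat.card H = 9 := by
    rw [Nat.card_congr e.toEquiv, Nat.card_prod]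
    simp
  have hpow : ∀ h : H, h ^ 3 = 1 := by
    intro h
    apply e.injective
    rw [map_pow, map_one]
    generalize e h = x
    revert x
    decide
  -- The nine elements of `H` cannot have distinct values at `0`.
  obtain ⟨h, k, hne, heq⟩ : ∃ h k : H, h ≠ k ∧ (h : Equiv.Perm (Fin 6)) 0 = (k : Equiv.Perm (Fin 6)) 0 := by
    by_contra! hcon
    have hinj : Function.Injective fun h : H => (h : Equiv.Perm (Fin 6)) 0 := fun h k hhk => by
      by_contra hne
      exact hcon h k hne hhk
    have := Nat.card_le_card_of_injective _ hinj
    simp [hcard] at this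
  set c : H := k⁻¹ * h
  have hc1 : (c : Equiv.Perm (Fin 6)) ≠ 1 := by
    intro hc
    have : c = 1 := Subtype.ext hc
    exact hne (inv_mul_eq_one.1 this).symm
  have hc0 : (c : Equiv.Perm (Fin 6)) 0 = 0 := by
    simp [c, heq]
  have hord : orderOf (c : Equiv.Perm (Fin 6)) = 3 :=
    orderOf_eq_prime (by exact_mod_cast congrArg Subtype.val (hpow c)) hc1
  refine ⟨c, hHG c.2, ?_⟩
  obtain ⟨n, hn⟩ := Equiv.Perm.cycleType_prime_order
    (σ := (c : Equiv.Perm (Fin 6))) (by rw [hord]; exact Nat.prime_three)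
  have hsum := Equiv.Perm.sum_cycleType (c : Equiv.Perm (Fin 6))
  have hlt : (c : Equiv.Perm (Fin 6)).support.card < 6 := by
    refine lt_of_lt_of_eq (Finset.card_lt_univ_of_notMem (x := 0) ?_) (Fintype.card_fin 6)
    simp [hc0]
  rw [hn, hord] at hsum
  simp at hsum
  have hn0 : n = 0 := by omega
  rw [Equiv.Perm.IsThreeCycle, hn, hn0, hord]
  rfl

/-- By Jordan's theorem a primitive group with a 3-cycle contains the alternating group, which has
index two. -/
theorem not_isPreprimitive_of_isThreeCycle {G : Subgroup (Equiv.Perm (Fin 6))}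
    {c : Equiv.Perm (Fin 6)} (hc : c.IsThreeCycle) (hcG : c ∈ G)
    (hA : G ≠ alternatingGroup (Fin 6)) (hT : G ≠ ⊤) : ¬ MulAction.IsPreprimitive G (Fin 6) := by
  intro hprim
  have hle := Equiv.Perm.alternatingGroup_le_of_isPreprimitive_of_isThreeCycle_mem hprim hc hcG
  obtain ⟨g, hgG, hg⟩ : ∃ g ∈ G, g ∉ alternatingGroup (Fin 6) := by
    by_contra! hcon
    exact hA (le_antisymm hcon hle)
  refine hT (eq_top_iff.2 fun σ _ => ?_)
  by_cases hσ : σ ∈ alternatingGroup (Fin 6)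
  · exact hle hσ
  · have h : g⁻¹ * σ ∈ alternatingGroup (Fin 6) := by
      rw [Equiv.Perm.mem_alternatingGroup] at hg hσ ⊢
      rw [map_mul, map_inv, (Int.units_eq_one_or _).resolve_left hg,
        (Int.units_eq_one_or _).resolve_left hσ]
      rfl
    simpa using G.mul_mem hgG (hle h)

theorem exists_perm_of_forall_mem {α : Type*} {f f' : Fin 3 → α} (hf : Function.Injective f)
    (h : ∀ i, ∃ j, f i = f' j) : ∃ π : Equiv.Perm (Fin 3), ∀ i, f i = f' (π i) := by
  choose π hπ using h
  have hinj : Function.Injective π := fun i j hij => hf (by rw [hπ, hπ, hij])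
  exact ⟨Equiv.ofBijective π (Finite.injective_iff_bijective.1 hinj), hπ⟩

/-- The six points can be labelled by two blocks `a`, `b` of size three that are permuted by `G`, such
that `G` contains the rotation of each block that fixes the other one, and an element that maps
`a i` to `b i`. -/
theorem exists_block_labelling {G : Subgroup (Equiv.Perm (Fin 6))}
    (hG : MulAction.IsPretransitive G (Fin 6)) (hC : ContainsC3C3 G)
    (hA : G ≠ alternatingGroup (Fin 6)) (hT : G ≠ ⊤) :
    ∃ a b : Fin 3 → Fin 6, Function.Bijective (Sum.elim a b) ∧
      (∀ g ∈ G, ∃ π π' : Equiv.Perm (Fin 3), ((∀ i, g (a i) = a (π i)) ∧ ∀ i, g (b i) = b (π' i)) ∨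
        ((∀ i, g (a i) = b (π i)) ∧ ∀ i, g (b i) = a (π' i))) ∧
      (∃ c ∈ G, (∀ i, c (a i) = a (i + 1)) ∧ ∀ i, c (b i) = b i) ∧
      (∃ d ∈ G, (∀ i, d (a i) = a i) ∧ ∀ i, d (b i) = b (i + 1)) ∧
      ∃ τ ∈ G, ∀ i, τ (a i) = b i := by
  classical
  obtain ⟨c, hcG, hc⟩ := hC.exists_isThreeCycle
  obtain ⟨B₀, hB₀, hnt⟩ : ∃ B : Set (Fin 6), MulAction.IsBlock G B ∧ ¬ MulAction.IsTrivialBlock B := by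
    by_contra! hcon
    exact not_isPreprimitive_of_isThreeCycle hc hcG hA hT ⟨fun {B} hB => hcon B hB⟩
  rw [MulAction.IsTrivialBlock, not_or, Set.not_subsingleton_iff] at hnt
  have hc3 : c ^ 3 = 1 := by rw [← hc.orderOf]; exact pow_orderOf_eq_one c
  have hcard := hc.card_support
  obtain ⟨p, hp⟩ : ∃ p, c p ≠ p := by
    by_contra! hcon
    rw [show c = 1 from Equiv.ext hcon] at hcard
    simp at hcard
  have hccc : ∀ x, c (c (c x)) = x := fun x => by
    have := DFunLike.congr_fun hc3 x
    simpa [pow_succ] using this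
  have hcp2 : c (c p) ≠ p := fun h => hp (by have := hccc p; rw [h] at this; exact this)
  have hcp3 : c (c p) ≠ c p := fun h => hp (c.injective h)
  have hsupp : c.support = {p, c p, c (c p)} := by
    symm
    apply Finset.eq_of_subset_of_card_le
    · intro x hx
      simp only [Finset.mem_insert, Finset.mem_singleton] at hx
      rw [Equiv.Perm.mem_support]
      rcases hx with rfl | rfl | rfl
      · exact hp
      · exact hcp3
      · rw [hccc]; exact hcp2.symm
    · rw [hcard, Finset.card_insert_of_notMem, Finset.card_insert_of_notMem, Finset.card_singleton]
      · simpa using hcp3.symm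
      · simp [hp.symm, hcp2.symm]
  obtain ⟨q, hq⟩ := hnt.1.nonempty
  obtain ⟨g₀, hg₀⟩ := MulAction.exists_smul_eq G q p
  set B : Set (Fin 6) := g₀ • B₀
  have hB : MulAction.IsBlock G B := hB₀.translate g₀
  have hpB : p ∈ B := ⟨q, hq, hg₀⟩
  have hBnt : B.Nontrivial := hnt.1.image (MulAction.injective g₀)
  have hBuniv : B ≠ Set.univ := fun h => hnt.2 (by simpa [B] using h)
  have hdich : ∀ g ∈ G, (∀ x, g x ∈ B ↔ x ∈ B) ∨ ∀ x ∈ B, g x ∉ B := by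
    intro g hg
    rcases hB.smul_eq_or_disjoint ⟨g, hg⟩ with h | h
    · left
      intro x
      have h1 : g x ∈ (⟨g, hg⟩ : G) • B ↔ x ∈ B := Set.smul_mem_smul_set_iff (a := (⟨g, hg⟩ : G))
      rwa [h] at h1
    · right
      intro x hx hgx
      exact Set.disjoint_left.1 h (Set.smul_mem_smul_set (a := (⟨g, hg⟩ : G)) hx) hgx
  -- If `c` moved `B` off itself, `B` could contain neither a fixed point of `c` nor, besides `p`,
  -- another point of the support, since such a point is mapped to or from `p`.
  have hcB : ∀ x, c x ∈ B ↔ x ∈ B := by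
    refine (hdich c hcG).resolve_right fun hdis => ?_
    obtain ⟨r, hr, hrp⟩ := hBnt.exists_ne p
    by_cases hcr : c r = r
    · exact hdis r hr (by rwa [hcr])
    · have : r ∈ c.support := Equiv.Perm.mem_support.2 hcr
      simp only [hsupp, Finset.mem_insert, Finset.mem_singleton] at this
      rcases this with rfl | rfl | rfl
      · exact hrp rfl
      · exact hdis p hpB hr
      · exact hdis _ hr (by rwa [hccc])
  set a : Fin 3 → Fin 6 := ![p, c p, c (c p)]
  have ha : Function.Injective a := by
    intro i j
    fin_cases i <;> fin_cases j <;> simp [a, hp, hp.symm, hcp2, hcp2.symm, hcp3, hcp3.symm]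
  have haB' : Set.range a ⊆ B := by
    rintro _ ⟨i, rfl⟩
    fin_cases i
    · exact hpB
    · exact (hcB p).2 hpB
    · exact (hcB _).2 ((hcB p).2 hpB)
  -- A proper block of a transitive group of degree six has at most three points.
  have hBcard : B.ncard = 3 := by
    have h1 : B.ncard ∣ 6 := by simpa using hB.ncard_dvd_card ⟨p, hpB⟩
    have h2 : 3 ≤ B.ncard := by
      have := Set.ncard_le_ncard haB'
      rwa [Set.ncard_range_of_injective ha, Nat.card_fin] at this
    have h3 : B.ncard ≠ 6 := fun h =>
      hBuniv (Set.eq_of_subset_of_ncard_le (Set.subset_univ B) (by simp [h]))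
    have h4 : B.ncard ≤ 6 := Nat.le_of_dvd (by norm_num) h1
    interval_cases B.ncard <;> omega
  have haB : Set.range a = B := by
    apply Set.eq_of_subset_of_ncard_le haB'
    rw [hBcard, Set.ncard_range_of_injective ha, Nat.card_fin]
  have hmemB : ∀ x, x ∈ B ↔ ∃ i, x = a i := fun x => by
    rw [← haB]; exact ⟨fun ⟨i, h⟩ => ⟨i, h.symm⟩, fun ⟨i, h⟩ => ⟨i, h.symm⟩⟩
  obtain ⟨s, hs⟩ := (Set.ne_univ_iff_exists_notMem B).1 hBuniv
  obtain ⟨⟨τ, hτG⟩, hτ⟩ := MulAction.exists_smul_eq G p s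
  replace hτ : τ p = s := hτ
  have hτB : ∀ x ∈ B, τ x ∉ B := (hdich τ hτG).resolve_left fun h => hs (hτ ▸ (h p).2 hpB)
  have haB1 : ∀ i, a i ∈ B := fun i => haB' ⟨i, rfl⟩
  set b : Fin 3 → Fin 6 := fun i => τ (a i)
  have hb : Function.Injective b := τ.injective.comp ha
  have hbB : ∀ i, b i ∉ B := fun i => hτB _ (haB1 i)
  have hbij : Function.Bijective (Sum.elim a b) := by
    rw [Fintype.bijective_iff_injective_and_card]
    refine ⟨ha.sumElim hb fun i j h => hbB j (h ▸ haB1 i), by simp⟩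
  have hnotB : ∀ x, x ∉ B → ∃ i, x = b i := by
    intro x hx
    obtain ⟨i | i, hi⟩ := hbij.2 x
    · exact absurd (hi ▸ haB1 i) hx
    · exact ⟨i, hi.symm⟩
  have hca : ∀ i, c (a i) = a (i + 1) := by
    intro i
    fin_cases i <;> simp [a, hccc]
  have hcb : ∀ i, c (b i) = b i := by
    intro i
    by_contra h
    have h1 : b i ∈ c.support := Equiv.Perm.mem_support.2 h
    simp only [hsupp, Finset.mem_insert, Finset.mem_singleton] at h1
    rcases h1 with h1 | h1 | h1
    · exact hbB i (h1 ▸ haB1 0)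
    · exact hbB i (h1 ▸ haB1 1)
    · exact hbB i (h1 ▸ haB1 2)
  refine ⟨a, b, hbij, fun g hg => ?_, ⟨c, hcG, hca, hcb⟩, ⟨τ * c * τ⁻¹,
    G.mul_mem (G.mul_mem hτG hcG) (G.inv_mem hτG), fun i => ?_, fun i => ?_⟩, τ, hτG, fun _ => rfl⟩
  · rcases hdich g hg with h | h
    · obtain ⟨π, hπ⟩ := exists_perm_of_forall_mem (g.injective.comp ha) (f' := a)
        fun i => (hmemB _).1 ((h _).2 (haB1 i))
      obtain ⟨π', hπ'⟩ := exists_perm_of_forall_mem (g.injective.comp hb) (f' := b)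
        fun i => hnotB _ fun hi => hbB i ((h _).1 hi)
      exact ⟨π, π', Or.inl ⟨hπ, hπ'⟩⟩
    · obtain ⟨π, hπ⟩ := exists_perm_of_forall_mem (g.injective.comp ha) (f' := b)
        fun i => hnotB _ (h _ (haB1 i))
      obtain ⟨π', hπ'⟩ := exists_perm_of_forall_mem (g.injective.comp hb) (f' := a) fun i => by
        rw [← hmemB]
        by_contra hi
        obtain ⟨j, hj⟩ := hnotB _ hi
        have h1 := hπ (π.symm j)
        rw [Equiv.apply_symm_apply, ← hj] at h1
        exact hbB i (g.injective h1 ▸ haB1 _)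
      exact ⟨π, π', Or.inr ⟨hπ, hπ'⟩⟩
  · have h1 : τ⁻¹ (a i) ∉ B := fun h => hτB _ h (by simpa using haB1 i)
    obtain ⟨j, hj⟩ := hnotB _ h1
    rw [Equiv.Perm.mul_apply, Equiv.Perm.mul_apply, hj, hcb, ← hj]
    exact τ.apply_symm_apply (a i)
  · simp [b, hca]

/-! ### Noether's problem -/

theorem noetherProblemPositive_of_containsC3C3 {K : Type*} [Field K] (h2 : (2 : K) ≠ 0)
    (G : Subgroup (Equiv.Perm (Fin 6))) (hG : MulAction.IsPretransitive G (Fin 6))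
    (hC : ContainsC3C3 G) (hA : G ≠ alternatingGroup (Fin 6)) (hT : G ≠ ⊤) :
    NoetherProblemPositive G K := by
  obtain ⟨a, b, hbij, hblock, ⟨c, hcG, hca, hcb⟩, ⟨d, hdG, hda, hdb⟩, τ, hτG, hτ⟩ :=
    exists_block_labelling hG hC hA hT
  refine noetherProblemPositive_of_isPretransitive (α := Fin 6) fun {E} _ _ ρ y hy hρ => ?_
  have hρ' : ∀ g, ∀ hg : g ∈ G, ∀ i, ρ ⟨g, hg⟩ (y i) = y (g i) := fun g hg i => hρ ⟨g, hg⟩ i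
  have hind : AlgebraicIndependent K (Sum.elim (y ∘ a) (y ∘ b)) := by
    rw [← Sum.comp_elim]
    exact hy.comp _ hbij.1
  have hperm : ∀ g, ∃ π π' : Equiv.Perm (Fin 3),
      (ρ g ∘ (y ∘ a) = (y ∘ a) ∘ π ∧ ρ g ∘ (y ∘ b) = (y ∘ b) ∘ π') ∨
      (ρ g ∘ (y ∘ a) = (y ∘ b) ∘ π ∧ ρ g ∘ (y ∘ b) = (y ∘ a) ∘ π') := by
    rintro ⟨g, hg⟩
    obtain ⟨π, π', ⟨h, h'⟩ | ⟨h, h'⟩⟩ := hblock g hg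
    · exact ⟨π, π', Or.inl ⟨funext fun i => by simp [hρ', h], funext fun i => by simp [hρ', h']⟩⟩
    · exact ⟨π, π', Or.inr ⟨funext fun i => by simp [hρ', h], funext fun i => by simp [hρ', h']⟩⟩
  have hfaith : ∀ g, ρ g ∘ (y ∘ a) = y ∘ a → ρ g ∘ (y ∘ b) = y ∘ b → g = 1 := by
    rintro ⟨g, hg⟩ h h'
    ext1
    ext1 i
    apply hy.injective
    rw [← hρ' g hg]
    obtain ⟨j | j, rfl⟩ := hbij.2 i
    · exact congrFun h j
    · exact congrFun h' j
  obtain ⟨F, P, W, h1, h3, h4, h5, h6, h7, h8⟩ := exists_generators_of_blocks h2 ρ hind hperm hfaith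
    ⟨⟨c, hcG⟩, fun i => by simp [hρ', hca], fun i => by simp [hρ', hcb]⟩
    ⟨⟨d, hdG⟩, fun i => by simp [hρ', hda], fun i => by simp [hρ', hdb]⟩
    ⟨⟨τ, hτG⟩, fun i => by simp [hρ', hτ]⟩
  refine ⟨F, P, W, h1, h3, h4, h5, fun i => ?_, h8⟩
  obtain ⟨j | j, rfl⟩ := hbij.2 i
  · exact h6 j
  · exact h7 j

theorem corollary1p2 {K : Type*} [Field K] (h2 : ringChar K ≠ 2) (h3 : ringChar K ≠ 3) :
    (∀ G : Subgroup (Equiv.Perm (Fin 6)), MulAction.IsPretransitive G (Fin 6) →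
      ContainsC3C3 G → G ≠ alternatingGroup (Fin 6) → G ≠ ⊤ →
      NoetherProblemPositive G K) ∧
    (ringChar K ≠ 5 → NoetherProblemPositive (Equiv.Perm (Fin 6)) K) :=
  ⟨fun G hG hC hA hT => noetherProblemPositive_of_containsC3C3 (Ring.two_ne_zero h2) G hG hC hA hT,
    fun _ => noetherProblemPositive_perm K (Fin 6)⟩
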